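/- Let $d\ge 1$, $k\ge 2$, and let $X^{(1)},X^{(2)},\dots$ be independent random vectors in $\mathbb{R}^d$ with common continuous distribution function $F$, whose margins are $F_1,\dots,F_d$. For a univariate distribution function $H$ put $H^{-1}(q)=\inf\{t\in\mathbb{R}: H(t)\ge q\}$, $q\in(0,1)$, and let $C_F(u)=F\bigl(F_1^{-1}(u_1),\dots,F_d^{-1}(u_d)\bigr)$, $u\in(0,1)^d$, be the copula of $F$. Suppose that, for some $\delta>0$, $C_F$ is in the $\delta$-neighborhood of a generalized Pareto copula, i.e. there is a norm $\|\cdot\|_D$ on $\mathbb{R}^d$ with $$C_F(u)=1-\|u-\mathbf 1\|_D+O\bigl(\|u-\mathbf 1\|_D^{1+\delta}\bigr)\qquad\text{as } u\uparrow\mathbf 1=(1,\dots,1).$$ For each $n$ let $M(n)\subseteq\{1,\dots,n\}$ and $m_n=|M(n)|$. Let $\hat F_{n,r}(x)=\frac1n\sum_{i=1}^n 1_{(-\infty,x]}\bigl(X^{(i)}_r\bigr)$, $1\le r\le d$, be the marginal empirical distribution functions, and for $0<c<1$ and $1\le j\le k$ put $$\hat n_{j}(c)=\Bigl|\Bigl\{i\in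 M(n):\ X^{(i)}_r>\hat F_{n,r}^{-1}\bigl(1-\tfrac cj\bigr)\text{ for at least one } r\in\{1,\dots,d\}\Bigr\}\Bigr|,$$ $$\hat T_n(c)=\frac{\sum_{j=1}^k\Bigl(j\,\hat n_{j}(c)-\frac1k\sum_{\ell=1}^k\ell\,\hat n_{\ell}(c)\Bigr)^2}{\frac1k\sum_{\ell=1}^k\ell\,\hat n_{\ell}(c)}$$ (with $\hat T_n(c):=0$ if the denominator vanishes). Let $c_n\in(0,1)$ and suppose that, as $n\to\infty$, $$m_n\to\infty,\qquad \frac{m_n\log m_n}{n}\to0,\qquad c_n\to0,\qquad m_nc_n\to\infty,\qquad m_nc_n^{1+2\delta}\to0 .$$ Then $\hat T_n(c_n)$ converges in distribution, as $n\to\infty$, to $$\sum_{i=1}^{k-1}\lambda_i\xi_i^2,\qquad \lambda_i=\frac1{4\sin^2\left(\frac ik\,\frac\pi2\right)},$$ where $\xi_1,\dots,\xi_{k-1}$ are independent standard normal random variables. -/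

import Mathlib

open MeasureTheory ProbabilityTheory Filter Topology Asymptotics

noncomputable section

/-- The joint distribution function `F(x) = μ(X ≤ x)` (componentwise order) of a law `μ` on `ℝ^d`. -/
def jointCDF {d : ℕ} (μ : Measure (Fin d → ℝ)) (x : Fin d → ℝ) : ℝ :=
  μ.real (Set.Iic x)

/-- The `r`-th marginal distribution function `F_r` of a law `μ` on `ℝ^d`. -/
def marginalCDF {d : ℕ} (μ : Measure (Fin d → ℝ)) (r : Fin d) (t : ℝ) : ℝ :=
  cdf (μ.map (fun x => x r)) t

/-- The generalized inverse `H⁻¹(q) = inf {t : H(t) ≥ q}`, used for `q ∈ (0,1)`. -/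
def genInv (H : ℝ → ℝ) (q : ℝ) : ℝ :=
  sInf {t : ℝ | q ≤ H t}

/-- The copula `C_F(u) = F(F_1⁻¹(u_1), …, F_d⁻¹(u_d))`, `u ∈ (0,1)^d`, of the law `μ` with
distribution function `F`. Outside the open cube the value is not used. -/
def copulaOf {d : ℕ} (μ : Measure (Fin d → ℝ)) (u : Fin d → ℝ) : ℝ :=
  jointCDF μ (fun r => genInv (marginalCDF μ r) (u r))

/-- The copula `C` on `ℝ^d` is in the `δ`-neighborhood of a generalized Pareto copula: for some norm
`‖·‖_D` on `ℝ^d` one has `C(u) - (1 - ‖u - 1‖_D) = O(‖u - 1‖_D^(1+δ))` as `u ↑ 1`, uniformly in the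
direction. (A norm for which this holds is a D-norm, a D-norm being by definition a norm for which
some copula satisfies this expansion with remainder `o(‖u - 1‖_D)`.) The variable `u` ranges over
the open cube `(0,1)^d`, on which `copulaOf` is defined; since a copula is continuous on `[0,1]^d`,
this is the same as letting it range over `[0,1]^d`. -/
def InDeltaNeighborhood {d : ℕ} (C : (Fin d → ℝ) → ℝ) (δ : ℝ) : Prop :=
  ∃ normD : Seminorm ℝ (Fin d → ℝ), (∀ x, normD x = 0 → x = 0) ∧
    (fun u : Fin d → ℝ => C u - (1 - normD (u - 1)))
      =O[𝓝[Set.univ.pi fun _ => Set.Ioo (0 : ℝ) 1] (1 : Fin d → ℝ)]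
    (fun u : Fin d → ℝ => normD (u - 1) ^ (1 + δ))

/-- The `r`-th marginal empirical distribution function of the sample `x 1, …, x n` in `ℝ^d`:
`n⁻¹ ∑_{i=1}^n 1_{(-∞, t]}(x i r)`. -/
def empCDF {d : ℕ} (x : ℕ → Fin d → ℝ) (n : ℕ) (r : Fin d) (t : ℝ) : ℝ :=
  (n : ℝ)⁻¹ * ∑ i ∈ Finset.Icc 1 n, Set.indicator (Set.Iic t) (fun _ => (1 : ℝ)) (x i r)

open scoped Classical in
/-- The number of those `i ∈ M` for which `x i` exceeds, in at least one component `r`, the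
empirical marginal quantile of level `1 - c / j` computed from the whole sample `x 1, …, x n`. -/
def hatCount {d : ℕ} (x : ℕ → Fin d → ℝ) (n : ℕ) (M : Finset ℕ) (j : ℕ) (c : ℝ) : ℕ :=
  (M.filter fun i => ∃ r : Fin d, genInv (empCDF x n r) (1 - c / (j : ℝ)) < x i r).card

/-- The average `k⁻¹ ∑_{ℓ=1}^k ℓ n̂_ℓ(c)`. -/
def hatMean {d : ℕ} (k : ℕ) (x : ℕ → Fin d → ℝ) (n : ℕ) (M : Finset ℕ) (c : ℝ) : ℝ :=
  (1 / (k : ℝ)) * ∑ l ∈ Finset.Icc 1 k, (l : ℝ) * (hatCount x n M l c : ℝ)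

/-- The test statistic `T̂_n(c)`. It is `0` where its denominator vanishes. -/
def hatT {d : ℕ} (k : ℕ) (x : ℕ → Fin d → ℝ) (n : ℕ) (M : Finset ℕ) (c : ℝ) : ℝ :=
  (∑ j ∈ Finset.Icc 1 k, ((j : ℝ) * (hatCount x n M j c : ℝ) - hatMean k x n M c) ^ 2) /
    hatMean k x n M c

/-- The weights `λ_i = 1 / (4 sin²((i / k) (π / 2)))`, `1 ≤ i ≤ k - 1`. -/
def limitWeight (k i : ℕ) : ℝ :=
  1 / (4 * Real.sin ((i : ℝ) / (k : ℝ) * (Real.pi / 2)) ^ 2)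

end

/-! Let `a = D 1`, the D-norm of the all-ones vector, and `q n = m_n c_n a`. If the true marginal
quantiles replaced the empirical ones, the counts would be numbers of hits of nested sets `exceedSet
μ (c / j)`, each of probability `c a / j + O(c^(1+δ))`. The covariance of the `j`-th and `l`-th
counts is then asymptotically `q / max j l`; after multiplication by `j l` it becomes `q * min j l`,
the covariance of a random walk. The expectations of `j n_j` are all close to `q`, with an error
negligible against `√q` because `m c^(1+2δ) → 0`.

The numerator of the statistic is the squared length of the projection of `(j n_j)` onto the
orthogonal complement of the constants. On that space the matrix `min j l` is diagonalised by
discrete cosine vectors with eigenvalues `limitWeight k i` (`sum_min_mul_cosBasis_mul_cosBasis`),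
and Parseval (`sum_sq_sub_mean_eq_sum_cosBasis`) splits the numerator accordingly. The cosine
coefficients, whitened and divided by `√q`, are asymptotically independent standard normal
(`tendstoInDistribution_nested_counts`), while the denominator divided by `q` tends to 1. Slutsky
and continuous mapping give the limit (`tendstoInDistribution_quadratic_statistic`).

It remains to replace the empirical quantiles (`tendstoInMeasure_hatCount_sub_hitCount`). By
Chebyshev they lie in windows of probability `2 c s` around the true ones, and such a window
contains `o(√q)` of the observations indexed by `M n`. A suitable `s` exists because `m / n → 0`. -/

noncomputable section

/-! ### The cosine basis and the spectrum of the projected matrix `min j l`. -/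

/-- The entries of the orthonormal discrete cosine basis of `ℝ^k`. -/
def cosBasis (k i j : ℕ) : ℝ :=
  √(2 / k) * Real.cos ((2 * j + 1) * (i * Real.pi / (2 * k)))

/-- Telescoping: `2 sin x cos ((2j+1)x) = sin ((2j+2)x) - sin (2jx)`. -/
lemma sum_cos_odd_mul_two_sin (x : ℝ) (n : ℕ) :
    (∑ j ∈ Finset.range n, Real.cos ((2 * j + 1) * x)) * (2 * Real.sin x) =
      Real.sin (2 * n * x) := by
  induction n with
  | zero => simp
  | succ n ih =>
    rw [Finset.sum_range_succ, add_mul, ih]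
    have h1 : Real.sin (2 * (n + 1 : ℕ) * x) = Real.sin ((2 * n + 1) * x + x) := by
      push_cast; ring_nf
    have h2 : Real.sin (2 * n * x) = Real.sin ((2 * n + 1) * x - x) := by ring_nf
    rw [h1, h2, Real.sin_add, Real.sin_sub]
    ring

lemma sum_cos_odd_eq_zero {k : ℕ} {x : ℝ} (p : ℤ) (hx : 2 * k * x = p * Real.pi)
    (hs : Real.sin x ≠ 0) : ∑ j ∈ Finset.range k, Real.cos ((2 * j + 1) * x) = 0 := by
  have h := sum_cos_odd_mul_two_sin x k
  rw [hx, Real.sin_int_mul_pi] at h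
  simpa [hs] using h

lemma sin_half_angle_pos {k i : ℕ} (hi : 1 ≤ i) (hik : i < 2 * k) :
    0 < Real.sin (i * Real.pi / (2 * k)) := by
  have hi' : (1 : ℝ) ≤ i := by exact_mod_cast hi
  have hk' : (i : ℝ) < 2 * k := by exact_mod_cast hik
  refine Real.sin_pos_of_pos_of_lt_pi 
    (div_pos (mul_pos (by linarith) Real.pi_pos) (by linarith)) ?_
  rw [div_lt_iff₀ (by linarith)]
  nlinarith [Real.pi_pos]

lemma sum_cosBasis {k i : ℕ} (hi : 1 ≤ i) (hik : i < k) :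
    ∑ j ∈ Finset.range k, cosBasis k i j = 0 := by
  have hk : (k : ℝ) ≠ 0 := by exact_mod_cast (by omega : k ≠ 0)
  unfold cosBasis
  rw [← Finset.mul_sum, sum_cos_odd_eq_zero (i : ℤ) (by push_cast; field_simp)
    (sin_half_angle_pos hi (by omega)).ne', mul_zero]

/-- Product-to-sum turns the product into cosines of frequencies `i - l` and `i + l`. Both lie below
`2k`, so each sums to zero unless it is `0`, which happens only for `i - l` on the diagonal. -/
lemma sum_cosBasis_mul_cosBasis {k i l : ℕ} (hi : 1 ≤ i) (hik : i < k) (hl : 1 ≤ l)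
    (hlk : l < k) :
    ∑ j ∈ Finset.range k, cosBasis k i j * cosBasis k l j = if i = l then 1 else 0 := by
  wlog hil : l ≤ i generalizing i l
  · rw [Finset.sum_congr rfl fun j _ => mul_comm (cosBasis k i j) _,
      this hl hlk hi hik (by omega)]
    simp [eq_comm]
  have hk : (k : ℝ) ≠ 0 := by exact_mod_cast (by omega : k ≠ 0)
  have hk0 : (0 : ℝ) ≤ 2 / k := by positivity
  have key : ∀ j : ℕ, cosBasis k i j * cosBasis k l j =
      (1 / k) * (Real.cos ((2 * j + 1) * (((i - l : ℕ) : ℝ) * Real.pi / (2 * k))) +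
        Real.cos ((2 * j + 1) * (((i + l : ℕ) : ℝ) * Real.pi / (2 * k)))) := by
    intro j
    have e1 : (2 * (j : ℝ) + 1) * (((i - l : ℕ) : ℝ) * Real.pi / (2 * k)) =
        (2 * j + 1) * (i * Real.pi / (2 * k)) - (2 * j + 1) * (l * Real.pi / (2 * k)) := by
      rw [Nat.cast_sub hil]; ring
    have e2 : (2 * (j : ℝ) + 1) * (((i + l : ℕ) : ℝ) * Real.pi / (2 * k)) =
        (2 * j + 1) * (i * Real.pi / (2 * k)) + (2 * j + 1) * (l * Real.pi / (2 * k)) := by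
      push_cast; ring
    rw [e1, e2, Real.cos_sub, Real.cos_add]
    unfold cosBasis
    linear_combination (Real.cos ((2 * j + 1) * (i * Real.pi / (2 * k))) *
      Real.cos ((2 * j + 1) * (l * Real.pi / (2 * k)))) * Real.mul_self_sqrt hk0
  have hadd := sum_cos_odd_eq_zero (k := k) ((i + l : ℕ) : ℤ)
    (x := ((i + l : ℕ) : ℝ) * Real.pi / (2 * k)) (by push_cast; field_simp)
    (sin_half_angle_pos (by omega) (by omega)).ne'
  rw [Finset.sum_congr rfl fun j _ => key j, ← Finset.mul_sum, Finset.sum_add_distrib, hadd,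
    add_zero]
  split_ifs with h
  · subst h
    simp [hk]
  · rw [sum_cos_odd_eq_zero ((i - l : ℕ) : ℤ) (by rw [Int.cast_natCast]; field_simp)
      (sin_half_angle_pos (by omega) (by omega)).ne', mul_zero]

lemma sum_sq_sub_mean (k : ℕ) (hk : 1 ≤ k) (v : ℕ → ℝ) :
    ∑ j ∈ Finset.range k, (v j - 1 / k * ∑ l ∈ Finset.range k, v l) ^ 2 =
      ∑ j ∈ Finset.range k, v j ^ 2 - 1 / k * (∑ l ∈ Finset.range k, v l) ^ 2 := by
  have hk0 : (k : ℝ) ≠ 0 := by exact_mod_cast (by omega : k ≠ 0)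
  set s := ∑ l ∈ Finset.range k, v l
  have : ∀ j, (v j - 1 / k * s) ^ 2 = v j ^ 2 - 2 / k * s * v j + (1 / k * s) ^ 2 := by
    intro j; ring
  simp_rw [this]
  rw [Finset.sum_add_distrib, Finset.sum_sub_distrib, ← Finset.mul_sum, Finset.sum_const,
    Finset.card_range, nsmul_eq_mul]
  change _ - 2 / k * s * s + _ = _
  field_simp
  ring

/-- Parseval's identity for the cosine basis of the orthogonal complement of the constants. -/
lemma sum_sq_sub_mean_eq_sum_cosBasis (k : ℕ) (hk : 1 ≤ k) (v : ℕ → ℝ) :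
    ∑ j ∈ Finset.range k, (v j - 1 / k * ∑ l ∈ Finset.range k, v l) ^ 2 =
      ∑ i : Fin (k - 1), (∑ j ∈ Finset.range k, cosBasis k (i + 1) j * v j) ^ 2 := by
  rw [sum_sq_sub_mean k hk]
  obtain ⟨m, rfl⟩ : ∃ m, k = m + 1 := ⟨k - 1, by omega⟩
  have hk0 : (0 : ℝ) < (m + 1 : ℕ) := by positivity
  -- The basis is completed by the normalised constant vector. Row `0` is defined separately because
  -- `cosBasis` at `i = 0` would have squared norm 2.
  let b : ℕ → ℕ → ℝ := fun i j => if i = 0 then √(1 / (m + 1 : ℕ)) else cosBasis (m + 1) i j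
  let O : Matrix (Fin (m + 1)) (Fin (m + 1)) ℝ := Matrix.of fun i j => b i j
  have hO : O * O.transpose = 1 := by
    ext i l
    rw [Matrix.mul_apply, Matrix.one_apply]
    simp only [O, Matrix.transpose_apply, Matrix.of_apply]
    rw [Fin.sum_univ_eq_sum_range (fun j => b i j * b l j) (m + 1)]
    by_cases hi : (i : ℕ) = 0 <;> by_cases hl : (l : ℕ) = 0
    · have : i = l := Fin.ext (by omega)
      simp only [b, hl, if_true, this]
      rw [Real.mul_self_sqrt (by positivity)]
      simp
      field_simp
    · have : i ≠ l := fun h => hl (h ▸ hi)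
      simp only [b, hi, hl, if_true, if_false, this]
      rw [← Finset.mul_sum, sum_cosBasis (by omega) l.2, mul_zero]
    · have : i ≠ l := fun h => hi (h ▸ hl)
      simp only [b, hi, hl, if_true, if_false, this]
      rw [← Finset.sum_mul, sum_cosBasis (by omega) i.2, zero_mul]
    · simp only [b, hi, hl, if_false]
      rw [sum_cosBasis_mul_cosBasis (by omega) i.2 (by omega) l.2]
      simp [Fin.ext_iff]
  have hO' : O.transpose * O = 1 := mul_eq_one_comm.mp hO
  let w : Fin (m + 1) → ℝ := fun j => v j
  have h1 : dotProduct (O.mulVec w) (O.mulVec w) = dotProduct w w := by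
    rw [Matrix.dotProduct_mulVec, Matrix.vecMul_mulVec, hO', Matrix.vecMul_one]
  have h2 : ∀ i : Fin (m + 1), O.mulVec w i = ∑ j ∈ Finset.range (m + 1), b i j * v j := by
    intro i
    rw [← Fin.sum_univ_eq_sum_range (fun j => b i j * v j) (m + 1)]
    rfl
  have h3 : dotProduct w w = ∑ j ∈ Finset.range (m + 1), v j ^ 2 := by
    rw [← Fin.sum_univ_eq_sum_range (fun j => v j ^ 2) (m + 1)]
    simp [dotProduct, w, sq]
  rw [h3, dotProduct, Fin.sum_univ_succ] at h1
  simp only [h2] at h1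
  have h4 : (∑ j ∈ Finset.range (m + 1), b ((0 : Fin (m + 1)) : ℕ) j * v j) *
      (∑ j ∈ Finset.range (m + 1), b ((0 : Fin (m + 1)) : ℕ) j * v j) =
      1 / (m + 1 : ℕ) * (∑ l ∈ Finset.range (m + 1), v l) ^ 2 := by
    simp only [b, Fin.val_zero, if_true]
    rw [← Finset.mul_sum]
    linear_combination (∑ l ∈ Finset.range (m + 1), v l) ^ 2 *
      Real.mul_self_sqrt (show (0 : ℝ) ≤ 1 / (m + 1 : ℕ) by positivity)
  rw [h4] at h1
  rw [← h1, add_sub_cancel_left]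
  refine Finset.sum_congr rfl fun i _ => ?_
  simp [b, sq]

lemma limitWeight_pos {k i : ℕ} (hi : 1 ≤ i) (hik : i < k) : 0 < limitWeight k i := by
  have h := sin_half_angle_pos hi (k := k) (by omega)
  unfold limitWeight
  rw [show (i : ℝ) / k * (Real.pi / 2) = i * Real.pi / (2 * k) by ring]
  positivity

/-- The two minima differ by the indicator of `l ≥ j + 1`, and a tail sum of a vector with total sum
zero is minus the head sum. -/
lemma sum_min_mul_succ_sub (k j : ℕ) (hj : j + 1 < k) (e : ℕ → ℝ)
    (he : ∑ l ∈ Finset.range k, e l = 0) :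
    ∑ l ∈ Finset.range k, ((min (j + 2) (l + 1) : ℕ) : ℝ) * e l -
      ∑ l ∈ Finset.range k, ((min (j + 1) (l + 1) : ℕ) : ℝ) * e l =
      - ∑ l ∈ Finset.range (j + 1), e l := by
  rw [← Finset.sum_sub_distrib]
  have h : ∀ l ∈ Finset.range k, ((min (j + 2) (l + 1) : ℕ) : ℝ) * e l -
      ((min (j + 1) (l + 1) : ℕ) : ℝ) * e l = e l - if l < j + 1 then e l else 0 := by
    intro l _
    split_ifs with hl
    · rw [min_eq_right (by omega : l + 1 ≤ j + 2), min_eq_right (by omega)]; ring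
    · rw [min_eq_left (by omega : j + 2 ≤ l + 1), min_eq_left (by omega)]; push_cast; ring
  rw [Finset.sum_congr rfl h, Finset.sum_sub_distrib, he, zero_sub, ← Finset.sum_filter]
  congr 2
  ext l; simp; omega

/-- The cosine basis vectors are, up to constants, eigenvectors of the covariance matrix
`min(j, l)` of a random walk. -/
lemma sum_min_mul_cosBasis {k i : ℕ} (hi : 1 ≤ i) (hik : i < k) (j : ℕ) (hj : j < k) :
    ∑ l ∈ Finset.range k, ((min (j + 1) (l + 1) : ℕ) : ℝ) * cosBasis k i l =
      limitWeight k i * cosBasis k i j +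
        (∑ l ∈ Finset.range k, ((min 1 (l + 1) : ℕ) : ℝ) * cosBasis k i l -
          limitWeight k i * cosBasis k i 0) := by
  induction j with
  | zero => simp
  | succ j ih =>
    have h1 := sum_min_mul_succ_sub k j hj (cosBasis k i) (sum_cosBasis hi hik)
    have h2 := ih (by omega)
    -- It suffices to match increments in `j`. With `x = iπ/(2k)`, the head sum is proportional to
    -- `sin (2(j+1)x) / (2 sin x)` and the cosine difference to `-2 sin (2(j+1)x) sin x`; their
    -- ratio produces the weight `1 / (4 sin² x)`.
    suffices h : - ∑ l ∈ Finset.range (j + 1), cosBasis k i l =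
        limitWeight k i * (cosBasis k i (j + 1) - cosBasis k i j) by
      rw [show j + 1 + 1 = j + 2 from rfl]
      linarith
    have hs := sin_half_angle_pos hi (k := k) (by omega)
    have h3 := sum_cos_odd_mul_two_sin (i * Real.pi / (2 * k)) (j + 1)
    unfold cosBasis limitWeight
    rw [show (i : ℝ) / k * (Real.pi / 2) = i * Real.pi / (2 * k) by ring, ← Finset.mul_sum]
    set x := (i : ℝ) * Real.pi / (2 * k)
    have e1 : Real.cos ((2 * (j + 1 : ℕ) + 1) * x) = Real.cos (2 * (j + 1 : ℕ) * x + x) := by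
      ring_nf
    have e2 : Real.cos ((2 * j + 1) * x) = Real.cos (2 * (j + 1 : ℕ) * x - x) := by
      push_cast; ring_nf
    rw [e1, e2, Real.cos_add, Real.cos_sub, ← h3]
    set S := ∑ l ∈ Finset.range (j + 1), Real.cos ((2 * l + 1) * x)
    field_simp
    ring

/-- The additive constant in `sum_min_mul_cosBasis` does not depend on `j`, so pairing with a vector
of sum zero removes it and leaves a genuine eigenvalue relation. -/
lemma sum_min_mul_cosBasis_mul_cosBasis {k i l : ℕ} (hi : 1 ≤ i) (hik : i < k) (hl : 1 ≤ l)
    (hlk : l < k) :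
    ∑ j ∈ Finset.range k, ∑ j' ∈ Finset.range k,
      cosBasis k i j * cosBasis k l j' * ((min (j + 1) (j' + 1) : ℕ) : ℝ) =
      if i = l then limitWeight k i else 0 := by
  have h : ∀ j ∈ Finset.range k, ∑ j' ∈ Finset.range k,
      cosBasis k i j * cosBasis k l j' * ((min (j + 1) (j' + 1) : ℕ) : ℝ) =
      limitWeight k l * (cosBasis k i j * cosBasis k l j) + cosBasis k i j *
        (∑ l' ∈ Finset.range k, ((min 1 (l' + 1) : ℕ) : ℝ) * cosBasis k l l' -
          limitWeight k l * cosBasis k l 0) := by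
    intro j hj
    have := sum_min_mul_cosBasis hl hlk j (Finset.mem_range.mp hj)
    calc _ = cosBasis k i j * ∑ l' ∈ Finset.range k,
        ((min (j + 1) (l' + 1) : ℕ) : ℝ) * cosBasis k l l' := by
          rw [Finset.mul_sum]; exact Finset.sum_congr rfl fun _ _ => by ring
      _ = _ := by rw [this]; ring
  rw [Finset.sum_congr rfl h, Finset.sum_add_distrib, ← Finset.mul_sum, ← Finset.sum_mul,
    sum_cosBasis hi hik, sum_cosBasis_mul_cosBasis hi hik hl hlk]
  split_ifs with h
  · simp [h]
  · simp

/-! ### A central limit theorem for triangular arrays, by characteristic functions. -/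

lemma norm_cexp_mul_I_sub_taylor_le {x : ℝ} (hx : |x| ≤ 1) :
    ‖Complex.exp (x * Complex.I) - (1 + x * Complex.I - x ^ 2 / 2)‖ ≤ |x| ^ 3 := by
  have hn : ‖(x : ℂ) * Complex.I‖ = |x| := by simp
  have h := Complex.exp_bound (x := x * Complex.I) (by rw [hn]; exact hx) (n := 3) (by norm_num)
  rw [hn] at h
  have e : ∑ m ∈ Finset.range 3, ((x : ℂ) * Complex.I) ^ m / (m.factorial : ℂ) =
      1 + x * Complex.I - x ^ 2 / 2 := by
    simp [Finset.sum_range_succ, Nat.factorial, mul_pow]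
    ring
  rw [e] at h
  refine h.trans (mul_le_of_le_one_right (by positivity) ?_)
  norm_num [Nat.factorial]

/-- Integrated Taylor expansion. The cubic remainder is at most `b * f ^ 2`, so a uniform bound
tending to zero takes the place of a Lindeberg condition. -/
lemma norm_integral_cexp_sub_le {E : Type*} [MeasurableSpace E] (μ : Measure E)
    [IsProbabilityMeasure μ] {f : E → ℝ} (hf : Measurable f) {b : ℝ} (hb : b ≤ 1)
    (hfb : ∀ x, |f x| ≤ b) :
    ‖(∫ x, Complex.exp (f x * Complex.I) ∂μ) -
      (1 + (∫ x, f x ∂μ : ℝ) * Complex.I - (∫ x, f x ^ 2 ∂μ : ℝ) / 2)‖ ≤ b * ∫ x, f x ^ 2 ∂μ := by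
  have if1 : Integrable f μ := .of_bound hf.aestronglyMeasurable b (ae_of_all _ hfb)
  have if2 : Integrable (fun x => f x ^ 2) μ := by
    refine .of_bound (hf.pow_const 2).aestronglyMeasurable (b ^ 2) (ae_of_all _ fun x => ?_)
    rw [Real.norm_eq_abs, abs_pow]
    exact pow_le_pow_left₀ (abs_nonneg _) (hfb x) 2
  have ic1 : Integrable (fun x => (f x : ℂ) * Complex.I) μ := if1.ofReal.mul_const _
  have ic2 : Integrable (fun x => (f x : ℂ) ^ 2 / 2) μ := by
    have := if2.ofReal (𝕜 := ℂ)
    simp only [Complex.coe_algebraMap, Complex.ofReal_pow] at this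
    simpa using this.div_const 2
  have ie : Integrable (fun x => Complex.exp (f x * Complex.I)) μ := by
    refine .of_bound (by fun_prop) 1 (ae_of_all _ fun x => ?_)
    rw [Complex.norm_exp_ofReal_mul_I]
  have ic3 : Integrable (fun x => (1 + f x * Complex.I : ℂ)) μ := (integrable_const 1).add ic1
  have ic4 : Integrable (fun x => (1 + f x * Complex.I - f x ^ 2 / 2 : ℂ)) μ := ic3.sub ic2
  have e : (1 + (∫ x, f x ∂μ : ℝ) * Complex.I - (∫ x, f x ^ 2 ∂μ : ℝ) / 2 : ℂ) =
      ∫ x, (1 + f x * Complex.I - f x ^ 2 / 2 : ℂ) ∂μ := by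
    rw [integral_sub ic3 ic2, integral_add (integrable_const _) ic1,
      integral_mul_const, integral_div, integral_complex_ofReal,
      ← integral_complex_ofReal (f := fun x => f x ^ 2)]
    simp
  rw [e, ← integral_sub ie ic4, ← integral_const_mul]
  refine norm_integral_le_of_norm_le (if2.const_mul b) (ae_of_all _ fun x => ?_)
  refine (norm_cexp_mul_I_sub_taylor_le ((hfb x).trans hb)).trans ?_
  rw [pow_succ', sq_abs]
  exact mul_le_mul_of_nonneg_right (hfb x) (sq_nonneg _)

lemma norm_pow_sub_pow_le_mul {z w : ℂ} (hz : ‖z‖ ≤ 1) (hw : ‖w‖ ≤ 1) (m : ℕ) :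
    ‖z ^ m - w ^ m‖ ≤ m * ‖z - w‖ := by
  induction m with
  | zero => simp
  | succ m ih =>
    have : z ^ (m + 1) - w ^ (m + 1) = (z ^ m - w ^ m) * z + w ^ m * (z - w) := by ring
    rw [this]
    refine (norm_add_le _ _).trans ?_
    rw [norm_mul, norm_mul, norm_pow]
    have h1 : ‖z ^ m - w ^ m‖ * ‖z‖ ≤ m * ‖z - w‖ :=
      (mul_le_of_le_one_right (norm_nonneg _) hz).trans ih
    have h2 : ‖w‖ ^ m * ‖z - w‖ ≤ ‖z - w‖ :=
      mul_le_of_le_one_left (norm_nonneg _) (pow_le_one₀ (norm_nonneg _) hw)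
    push_cast
    linarith

/-- Comparison with `(1 + L / m) ^ m`. For real `L ≤ 0` this base has modulus at most 1 for large
`m`, so the two powers differ by at most `m` times the difference of the bases, which is `|m (z - 1)
- L|`. -/
lemma tendsto_pow_exp_of_tendsto_mul_sub_one {z : ℕ → ℂ} {m : ℕ → ℕ} {L : ℝ} (hL : L ≤ 0)
    (hm : Tendsto m atTop atTop) (hz : ∀ n, ‖z n‖ ≤ 1)
    (h : Tendsto (fun n => (m n : ℂ) * (z n - 1)) atTop (𝓝 L)) :
    Tendsto (fun n => z n ^ m n) atTop (𝓝 (Complex.exp L)) := by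
  have h1 := (Complex.tendsto_one_add_div_pow_exp (L : ℂ)).comp hm
  refine (tendsto_iff_of_dist ?_).mp h1
  have h2 : Tendsto (fun n => ‖(m n : ℂ) * (z n - 1) - L‖) atTop (𝓝 0) := by
    rw [← tendsto_iff_norm_sub_tendsto_zero]; exact h
  refine squeeze_zero' (Eventually.of_forall fun n => dist_nonneg) ?_ h2
  have hmr : Tendsto (fun n => (m n : ℝ)) atTop atTop := tendsto_natCast_atTop_atTop.comp hm
  filter_upwards [hmr.eventually_ge_atTop (max 1 (-L))] with n hn
  have hn1 : (1 : ℝ) ≤ m n := (le_max_left _ _).trans hn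
  have hn2 : -L ≤ m n := (le_max_right _ _).trans hn
  have hw : ‖1 + (L : ℂ) / m n‖ ≤ 1 := by
    rw [show (1 + (L : ℂ) / m n) = ((1 + L / m n : ℝ) : ℂ) by push_cast; ring, Complex.norm_real,
      Real.norm_eq_abs, abs_le]
    have h3 : L / m n ≤ 0 := div_nonpos_of_nonpos_of_nonneg hL (by linarith)
    have h4 : -1 ≤ L / m n := by rw [le_div_iff₀ (by linarith)]; linarith
    constructor <;> linarith
  rw [Function.comp_apply, dist_comm, dist_eq_norm]
  refine (norm_pow_sub_pow_le_mul (hz n) hw _).trans (le_of_eq ?_)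
  have hne : (m n : ℂ) ≠ 0 := by
    have : (m n : ℝ) ≠ 0 := by linarith
    exact_mod_cast this
  rw [show (m n : ℂ) * (z n - 1) - L = m n * (z n - (1 + L / m n)) by field_simp; ring, norm_mul,
    Complex.norm_natCast]

/-- Convergence of characteristic functions in the central limit theorem for a row-wise i.i.d.
triangular array with uniformly small summands. -/
lemma tendsto_integral_cexp_pow {E : Type*} [MeasurableSpace E] (μ : Measure E)
    [IsProbabilityMeasure μ] {f : ℕ → E → ℝ} (hf : ∀ n, Measurable (f n)) {b : ℕ → ℝ}
    (hfb : ∀ n x, |f n x| ≤ b n) (hb : Tendsto b atTop (𝓝 0)) {m : ℕ → ℕ}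
    (hm : Tendsto m atTop atTop) {v : ℝ} (hv : 0 ≤ v)
    (h1 : Tendsto (fun n => (m n : ℝ) * ∫ x, f n x ∂μ) atTop (𝓝 0))
    (h2 : Tendsto (fun n => (m n : ℝ) * ∫ x, f n x ^ 2 ∂μ) atTop (𝓝 v)) :
    Tendsto (fun n => (∫ x, Complex.exp (f n x * Complex.I) ∂μ) ^ m n) atTop
      (𝓝 (Complex.exp ((-(v / 2) : ℝ) : ℂ))) := by
  refine tendsto_pow_exp_of_tendsto_mul_sub_one (by linarith) hm (fun n => ?_) ?_
  · refine (norm_integral_le_integral_norm _).trans ?_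
    simp [Complex.norm_exp_ofReal_mul_I]
  have h3 : Tendsto (fun n => (((m n : ℝ) * ∫ x, f n x ∂μ : ℝ) : ℂ) * Complex.I -
      (((m n : ℝ) * ∫ x, f n x ^ 2 ∂μ : ℝ) : ℂ) / 2) atTop (𝓝 ((-(v / 2) : ℝ) : ℂ)) := by
    have h1' := (Complex.continuous_ofReal.tendsto _).comp h1
    have h2' := (Complex.continuous_ofReal.tendsto _).comp h2
    have := (h1'.mul_const Complex.I).sub (h2'.div_const 2)
    refine this.trans_eq ?_
    push_cast; simp
  refine (tendsto_iff_of_dist ?_).mp h3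
  have h4 : Tendsto (fun n => b n * ((m n : ℝ) * ∫ x, f n x ^ 2 ∂μ)) atTop (𝓝 0) := by
    simpa using hb.mul h2
  refine squeeze_zero' (Eventually.of_forall fun n => dist_nonneg) ?_ h4
  filter_upwards [hb.eventually_le_const zero_lt_one] with n hn
  have h5 := norm_integral_cexp_sub_le μ (hf n) hn (hfb n)
  rw [dist_comm, dist_eq_norm]
  calc _ = ‖(m n : ℂ) * ((∫ x, Complex.exp (f n x * Complex.I) ∂μ) -
      (1 + (∫ x, f n x ∂μ : ℝ) * Complex.I - (∫ x, f n x ^ 2 ∂μ : ℝ) / 2))‖ := by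
        congr 1; push_cast; ring
    _ = (m n : ℝ) * ‖(∫ x, Complex.exp (f n x * Complex.I) ∂μ) -
      (1 + (∫ x, f n x ∂μ : ℝ) * Complex.I - (∫ x, f n x ^ 2 ∂μ : ℝ) / 2)‖ := by
        rw [norm_mul, Complex.norm_natCast]
    _ ≤ (m n : ℝ) * (b n * ∫ x, f n x ^ 2 ∂μ) := by gcongr
    _ = _ := by ring

/-- Multivariate central limit theorem for row-wise i.i.d. triangular arrays of small summands,
with standard normal limit. -/
lemma tendstoInDistribution_sum_stdNormal {Ω Ω' E ι : Type*} [MeasurableSpace Ω]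
    [MeasurableSpace Ω'] [MeasurableSpace E] [Fintype ι] [DecidableEq ι]
    {P : Measure Ω} [IsProbabilityMeasure P] {P' : Measure Ω'} [IsProbabilityMeasure P']
    {μ : Measure E} [IsProbabilityMeasure μ] {X : ℕ → Ω → E} (hX : ∀ i, HasLaw (X i) μ P)
    (hindep : iIndepFun X P) {M : ℕ → Finset ℕ}
    (hM : Tendsto (fun n => (M n).card) atTop atTop)
    {ξ : ι → Ω' → ℝ} (hξ : ∀ i, HasLaw (ξ i) (gaussianReal 0 1) P') (hξi : iIndepFun ξ P')
    {T : ℕ → E → ι → ℝ} (hT : ∀ n i, Measurable fun x => T n x i) {b : ℕ → ℝ}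
    (hTb : ∀ n x i, |T n x i| ≤ b n) (hb : Tendsto b atTop (𝓝 0))
    (h1 : ∀ i, Tendsto (fun n => ((M n).card : ℝ) * ∫ x, T n x i ∂μ) atTop (𝓝 0))
    (h2 : ∀ i j, Tendsto (fun n => ((M n).card : ℝ) * ∫ x, T n x i * T n x j ∂μ) atTop
      (𝓝 (if i = j then 1 else 0))) :
    TendstoInDistribution (fun n ω => ∑ t ∈ M n, WithLp.toLp 2 (T n (X t ω))) atTop
      (fun ω => WithLp.toLp 2 fun i => ξ i ω) (fun _ => P) P' := by
  have hTm : ∀ n, Measurable fun x => (WithLp.toLp 2 (T n x) : EuclideanSpace ℝ ι) := fun n =>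
    (WithLp.measurable_toLp 2 (ι → ℝ)).comp (measurable_pi_lambda _ (hT n))
  have hTX : ∀ n t, AEMeasurable
      (fun ω => (WithLp.toLp 2 (T n (X t ω)) : EuclideanSpace ℝ ι)) P := fun n t =>
    (hTm n).comp_aemeasurable (hX t).aemeasurable
  have hξm : AEMeasurable (fun ω => (WithLp.toLp 2 fun i => ξ i ω : EuclideanSpace ℝ ι)) P' :=
    (WithLp.measurable_toLp 2 (ι → ℝ)).comp_aemeasurable
      (aemeasurable_pi_lambda _ fun i => (hξ i).aemeasurable)
  refine ⟨fun n => Finset.aemeasurable_fun_sum _ fun t _ => hTX n t, hξm, ?_⟩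
  refine ProbabilityMeasure.tendsto_of_tendsto_charFun fun s => ?_
  simp only [ProbabilityMeasure.coe_mk]
  have hlim : charFun (P'.map fun ω => (WithLp.toLp 2 fun i => ξ i ω : EuclideanSpace ℝ ι)) s =
      Complex.exp ((-((∑ i, s i ^ 2) / 2) : ℝ) : ℂ) := by
    rw [(iIndepFun_iff_charFun_pi fun i => (hξ i).aemeasurable).mp hξi s]
    simp_rw [(hξ _).map_eq, charFun_gaussianReal]
    rw [← Complex.exp_sum]
    congr 1
    push_cast
    rw [Finset.sum_div, ← Finset.sum_neg_distrib]
    refine Finset.sum_congr rfl fun i _ => ?_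
    simp
  rw [hlim]
  have hinner : ∀ n x, inner ℝ (WithLp.toLp 2 (T n x) : EuclideanSpace ℝ ι) s =
      ∑ i, s i * T n x i := by
    intro n x
    simp [PiLp.inner_apply]
  have hrow : ∀ n, charFun (P.map fun ω => ∑ t ∈ M n,
      (WithLp.toLp 2 (T n (X t ω)) : EuclideanSpace ℝ ι)) s =
      (∫ x, Complex.exp ((∑ i, s i * T n x i : ℝ) * Complex.I) ∂μ) ^ (M n).card := by
    intro n
    have hi : iIndepFun (fun t ω => (WithLp.toLp 2 (T n (X t ω)) : EuclideanSpace ℝ ι)) P :=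
      hindep.comp (fun _ x => WithLp.toLp 2 (T n x)) fun _ => hTm n
    rw [(hi.restrict (M n)).charFun_map_fun_finsetSum_eq_prod fun t _ => hTX n t,
      Finset.prod_apply]
    refine Finset.prod_eq_pow_card fun t _ => ?_
    rw [charFun_apply, integral_map (hTX n t) (by fun_prop)]
    simp_rw [hinner]
    exact (hX t).integral_comp (f := fun x => Complex.exp ((∑ i, s i * T n x i : ℝ) * Complex.I))
      (Measurable.aestronglyMeasurable (by fun_prop))
  simp_rw [hrow]
  have hint : ∀ n i, Integrable (fun x => T n x i) μ := fun n i =>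
    .of_bound (hT n i).aestronglyMeasurable (b n) (ae_of_all _ fun x => hTb n x i)
  have hint2 : ∀ n i j, Integrable (fun x => T n x i * T n x j) μ := fun n i j => by
    refine .of_bound ((hT n i).mul (hT n j)).aestronglyMeasurable (b n * b n)
      (ae_of_all _ fun x => ?_)
    rw [norm_mul]
    exact mul_le_mul (hTb n x i) (hTb n x j) (abs_nonneg _) ((abs_nonneg _).trans (hTb n x i))
  refine tendsto_integral_cexp_pow μ (f := fun n x => ∑ i, s i * T n x i)
    (b := fun n => ∑ i, |s i| * b n) (fun n => by fun_prop) (fun n x => ?_) ?_ hM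
    (Finset.sum_nonneg fun i _ => sq_nonneg _) ?_ ?_
  · refine (Finset.abs_sum_le_sum_abs _ _).trans (Finset.sum_le_sum fun i _ => ?_)
    rw [abs_mul]
    exact mul_le_mul_of_nonneg_left (hTb n x i) (abs_nonneg _)
  · simpa using tendsto_finsetSum Finset.univ fun i _ => hb.const_mul |s i|
  · have e : ∀ n, ((M n).card : ℝ) * ∫ x, ∑ i, s i * T n x i ∂μ =
        ∑ i, s i * (((M n).card : ℝ) * ∫ x, T n x i ∂μ) := by
      intro n
      rw [integral_finsetSum _ fun i _ => (hint n i).const_mul _, Finset.mul_sum]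
      refine Finset.sum_congr rfl fun i _ => ?_
      rw [integral_const_mul]; ring
    simp_rw [e]
    simpa using tendsto_finsetSum Finset.univ fun i _ => (h1 i).const_mul (s i)
  · have e : ∀ n, ((M n).card : ℝ) * ∫ x, (∑ i, s i * T n x i) ^ 2 ∂μ =
        ∑ i, ∑ j, s i * s j * (((M n).card : ℝ) * ∫ x, T n x i * T n x j ∂μ) := by
      intro n
      have : ∀ x, (∑ i, s i * T n x i) ^ 2 = ∑ i, ∑ j, s i * s j * (T n x i * T n x j) := by
        intro x
        rw [sq, Finset.sum_mul_sum]
        exact Finset.sum_congr rfl fun i _ => Finset.sum_congr rfl fun j _ => by ring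
      simp_rw [this]
      rw [integral_finsetSum _ fun i _ => integrable_finsetSum _ fun j _ =>
        (hint2 n i j).const_mul _, Finset.mul_sum]
      refine Finset.sum_congr rfl fun i _ => ?_
      rw [integral_finsetSum _ fun j _ => (hint2 n i j).const_mul _, Finset.mul_sum]
      refine Finset.sum_congr rfl fun j _ => ?_
      rw [integral_const_mul]; ring
    simp_rw [e]
    have := tendsto_finsetSum (Finset.univ : Finset ι) fun i _ =>
      tendsto_finsetSum (Finset.univ : Finset ι) fun j _ => (h2 i j).const_mul (s i * s j)
    simpa [sq] using this

/-! ### Tools for convergence in measure. -/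

/-- The common form of all later negligibility arguments: `ι = Bool` gives the triangle inequality,
and an empty sum covers functions that eventually vanish. -/
lemma tendstoInMeasure_zero_of_norm_le_sum {Ω F ι : Type*} [MeasurableSpace Ω] {P : Measure Ω}
    [SeminormedAddCommGroup F] {f : ℕ → Ω → F} {g : ι → ℕ → Ω → ℝ} (s : Finset ι) (C : ℝ)
    (h : ∀ᶠ n in atTop, ∀ ω, ‖f n ω‖ ≤ C * ∑ j ∈ s, |g j n ω|)
    (hg : ∀ j ∈ s, TendstoInMeasure P (g j) atTop 0) : TendstoInMeasure P f atTop 0 := by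
  rw [tendstoInMeasure_iff_norm]
  intro ε hε
  -- The added ones keep `η` positive when `C = 0` or `s` is empty, and make the final inequality
  -- strict.
  set η : ℝ := ε / ((|C| + 1) * (s.card + 1)) with hη
  have hη0 : 0 < η := by positivity
  have hlim : Tendsto (fun n => ∑ j ∈ s, P {ω | η ≤ ‖g j n ω - (0 : Ω → ℝ) ω‖}) atTop (𝓝 0) := by
    have := tendsto_finsetSum s fun j hj => (tendstoInMeasure_iff_norm.mp (hg j hj)) η hη0
    simpa using this
  refine tendsto_of_tendsto_of_tendsto_of_le_of_le' tendsto_const_nhds hlim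
    (Eventually.of_forall fun _ => zero_le) ?_
  filter_upwards [h] with n hn
  refine (measure_mono fun ω hω => ?_).trans (measure_biUnion_finset_le s _)
  simp only [Set.mem_ofPred_eq, Pi.zero_apply, sub_zero, Set.mem_iUnion, exists_prop,
    Real.norm_eq_abs] at hω ⊢
  by_contra! hlt
  have h1 : ∑ j ∈ s, |g j n ω| ≤ s.card * η := by
    rw [← nsmul_eq_mul]
    exact Finset.sum_le_card_nsmul _ _ _ fun j hj => (hlt j hj).le
  have h2 : C * ∑ j ∈ s, |g j n ω| ≤ |C| * (s.card * η) :=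
    mul_le_mul (le_abs_self C) h1 (Finset.sum_nonneg fun _ _ => abs_nonneg _) (abs_nonneg _)
  have h3 : (|C| + 1) * (s.card + 1) * η = ε := by rw [hη]; field_simp
  have h4 : |C| * (s.card * η) < ε := by
    nlinarith [mul_nonneg (abs_nonneg C) hη0.le, mul_nonneg (Nat.cast_nonneg (α := ℝ) s.card) hη0.le]
  linarith [hn ω]

lemma tendstoInMeasure_const_fun {Ω : Type*} [MeasurableSpace Ω] {P : Measure Ω}
    [IsFiniteMeasure P] {a : ℕ → ℝ} (ha : Tendsto a atTop (𝓝 0)) :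
    TendstoInMeasure P (fun n _ => a n) atTop (0 : Ω → ℝ) :=
  tendstoInMeasure_of_tendsto_ae (fun _ => aestronglyMeasurable_const) (ae_of_all _ fun _ => ha)

lemma TendstoInMeasure.inv_one {Ω : Type*} [MeasurableSpace Ω] {P : Measure Ω}
    {f : ℕ → Ω → ℝ} (h : TendstoInMeasure P f atTop fun _ => 1) :
    TendstoInMeasure P (fun n ω => (f n ω)⁻¹) atTop fun _ => 1 := by
  rw [tendstoInMeasure_iff_norm] at h ⊢
  intro ε hε
  refine tendsto_of_tendsto_of_tendsto_of_le_of_le tendsto_const_nhds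
    (h (min (1 / 2) (ε / 2)) (by positivity)) (fun _ => zero_le) fun n => measure_mono fun ω hω => ?_
  simp only [Set.mem_ofPred_eq, Real.norm_eq_abs] at hω ⊢
  by_contra! hlt
  have h1 := hlt.trans_le (min_le_left _ _)
  have h2 := hlt.trans_le (min_le_right _ _)
  have h3 : 1 / 2 < f n ω := by linarith [(abs_lt.mp h1).1]
  have h4 : (f n ω)⁻¹ - 1 = (1 - f n ω) * (f n ω)⁻¹ := by field_simp
  have h5 : (f n ω)⁻¹ ≤ 2 := by rw [inv_le_comm₀ (by linarith) (by norm_num)]; linarith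
  rw [h4, abs_mul, abs_sub_comm, abs_of_pos (show 0 < (f n ω)⁻¹ by positivity)] at hω
  nlinarith [abs_nonneg (f n ω - 1)]

/-! ### Counts of rare events. -/

/-- The number of indices `i ∈ S` with `X i ω ∈ A`, as a real random variable. -/
def hitCount {Ω E : Type*} (X : ℕ → Ω → E) (S : Finset ℕ) (A : Set E) (ω : Ω) : ℝ :=
  ∑ i ∈ S, A.indicator (fun _ => (1 : ℝ)) (X i ω)

section Counting

variable {Ω E : Type*} [MeasurableSpace Ω] [MeasurableSpace E] {P : Measure Ω}
  {μ : Measure E} {X : ℕ → Ω → E}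

lemma aemeasurable_indicator_comp (hX : ∀ i, HasLaw (X i) μ P) {A : Set E} (hA : MeasurableSet A)
    (i : ℕ) : AEMeasurable (fun ω => A.indicator (fun _ => (1 : ℝ)) (X i ω)) P :=
  (measurable_const.indicator hA).comp_aemeasurable (hX i).aemeasurable

lemma integral_indicator_comp (hX : ∀ i, HasLaw (X i) μ P) {A : Set E} (hA : MeasurableSet A)
    (i : ℕ) : ∫ ω, A.indicator (fun _ => (1 : ℝ)) (X i ω) ∂P = μ.real A := by
  have := (hX i).integral_comp (f := A.indicator fun _ => (1 : ℝ))
    (measurable_const.indicator hA).aestronglyMeasurable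
  rw [Function.comp_def] at this
  rw [this, integral_indicator_const _ hA, smul_eq_mul, mul_one]

variable [IsProbabilityMeasure P]

lemma memLp_indicator_comp (hX : ∀ i, HasLaw (X i) μ P) {A : Set E} (hA : MeasurableSet A)
    (i : ℕ) (p : ENNReal) : MemLp (fun ω => A.indicator (fun _ => (1 : ℝ)) (X i ω)) p P := by
  refine MemLp.of_bound (aemeasurable_indicator_comp hX hA i).aestronglyMeasurable 1
    (ae_of_all _ fun ω => ?_)
  by_cases h : X i ω ∈ A <;> simp [h]

lemma integral_hitCount (hX : ∀ i, HasLaw (X i) μ P) (S : Finset ℕ) {A : Set E}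
    (hA : MeasurableSet A) : ∫ ω, hitCount X S A ω ∂P = S.card * μ.real A := by
  unfold hitCount
  rw [integral_finsetSum _ fun i _ =>
    (memLp_indicator_comp hX hA i 1).integrable le_rfl]
  simp [integral_indicator_comp hX hA]

variable [IsProbabilityMeasure μ]

/-- Chebyshev's inequality with the binomial variance. -/
lemma measureReal_le_abs_hitCount_sub (hX : ∀ i, HasLaw (X i) μ P) (hindep : iIndepFun X P)
    (S : Finset ℕ) {A : Set E} (hA : MeasurableSet A) {η : ℝ} (hη : 0 < η) :
    P.real {ω | η ≤ |hitCount X S A ω - S.card * μ.real A|} ≤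
      S.card * (μ.real A * (1 - μ.real A)) / η ^ 2 := by
  have hmem := fun i => memLp_indicator_comp hX hA i 2
  have hvar : Var[hitCount X S A; P] = S.card * (μ.real A * (1 - μ.real A)) := by
    have hsum : hitCount X S A =
        ∑ i ∈ S, fun ω => A.indicator (fun _ => (1 : ℝ)) (X i ω) := by
      ext ω; simp [hitCount]
    have hind : iIndepFun (fun i ω => A.indicator (fun _ => (1 : ℝ)) (X i ω)) P :=
      hindep.comp (fun _ => A.indicator fun _ => (1 : ℝ)) fun _ => measurable_const.indicator hA
    rw [hsum, IndepFun.variance_sum (fun i _ => hmem i) fun i _ j _ hij => hind.indepFun hij,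
      ← nsmul_eq_mul]
    refine Finset.sum_eq_card_nsmul fun i _ => ?_
    rw [variance_eq_sub (hmem i)]
    have hsq : (fun ω => A.indicator (fun _ => (1 : ℝ)) (X i ω)) ^ 2 =
        fun ω => A.indicator (fun _ => (1 : ℝ)) (X i ω) := by
      ext ω
      by_cases h : X i ω ∈ A <;> simp [h]
    rw [hsq, integral_indicator_comp hX hA]
    ring
  have hm : MemLp (hitCount X S A) 2 P := by
    unfold hitCount
    exact memLp_finsetSum _ fun i _ => hmem i
  have h := meas_ge_le_variance_div_sq hm hη
  rw [hvar, integral_hitCount hX S hA] at h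
  have hp : 0 ≤ μ.real A * (1 - μ.real A) :=
    mul_nonneg measureReal_nonneg (by linarith [measureReal_le_one (μ := μ) (s := A)])
  exact ENNReal.toReal_le_of_le_ofReal (by positivity) h

/-- Weak law of large numbers for the counts of rare events, on the scale `q`. -/
lemma tendstoInMeasure_hitCount_div (hX : ∀ i, HasLaw (X i) μ P) (hindep : iIndepFun X P)
    {M : ℕ → Finset ℕ} {A : ℕ → Set E} (hA : ∀ n, MeasurableSet (A n)) {q : ℕ → ℝ}
    (hq : Tendsto q atTop atTop) {v : ℝ}
    (hv : Tendsto (fun n => ((M n).card : ℝ) * μ.real (A n) / q n) atTop (𝓝 v)) :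
    TendstoInMeasure P (fun n ω => hitCount X (M n) (A n) ω / q n - v) atTop 0 := by
  have h1 : TendstoInMeasure P (fun n ω =>
      (hitCount X (M n) (A n) ω - (M n).card * μ.real (A n)) / q n) atTop 0 := by
    rw [tendstoInMeasure_iff_measureReal_norm]
    intro ε hε
    have hlim : Tendsto (fun n => ((M n).card : ℝ) * μ.real (A n) / q n * (q n)⁻¹ * (ε ^ 2)⁻¹)
        atTop (𝓝 0) := by
      simpa using (hv.mul hq.inv_tendsto_atTop).mul_const ((ε ^ 2)⁻¹)
    refine squeeze_zero' (Eventually.of_forall fun _ => measureReal_nonneg) ?_ hlim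
    filter_upwards [hq.eventually_gt_atTop 0] with n hn
    have hset : {ω | ε ≤ ‖(hitCount X (M n) (A n) ω - (M n).card * μ.real (A n)) / q n -
        (0 : Ω → ℝ) ω‖} = {ω | ε * q n ≤ |hitCount X (M n) (A n) ω - (M n).card * μ.real (A n)|} := by
      ext ω
      simp only [Set.mem_ofPred_eq, Pi.zero_apply, sub_zero, Real.norm_eq_abs, abs_div,
        abs_of_pos hn, le_div_iff₀ hn]
    rw [hset]
    refine (measureReal_le_abs_hitCount_sub hX hindep (M n) (hA n) (by positivity)).trans ?_
    have h2 : μ.real (A n) * (1 - μ.real (A n)) ≤ μ.real (A n) :=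
      mul_le_of_le_one_right measureReal_nonneg (by linarith [measureReal_nonneg (μ := μ) (s := A n)])
    calc _ ≤ ((M n).card : ℝ) * μ.real (A n) / (ε * q n) ^ 2 := by gcongr
      _ = _ := by field_simp
  refine tendstoInMeasure_zero_of_norm_le_sum (ι := Bool) (g := fun b => if b then
    (fun n ω => (hitCount X (M n) (A n) ω - (M n).card * μ.real (A n)) / q n) else
    (fun n _ => ((M n).card : ℝ) * μ.real (A n) / q n - v)) Finset.univ 1
    (Eventually.of_forall fun n ω => ?_) ?_
  · simp only [Fintype.sum_bool, if_true, one_mul, Bool.false_eq_true, if_false, Real.norm_eq_abs]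
    refine le_trans (le_of_eq ?_) (abs_add_le _ _)
    congr 1; ring
  · rintro (_ | _) _
    · exact tendstoInMeasure_const_fun (a := fun n => ((M n).card : ℝ) * μ.real (A n) / q n - v)
        (by rw [← sub_self v]; exact hv.sub_const v)
    · exact h1

end Counting

/-! ### The quadratic statistic for nested rare events. -/

/-- The contribution of the `j`-th count to the whitened vector of cosine coefficients. -/
def cosVec (k j : ℕ) : EuclideanSpace ℝ (Fin (k - 1)) :=
  WithLp.toLp 2 fun i => (√(limitWeight k (i + 1)))⁻¹ * cosBasis k (i + 1) j * (j + 1)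

/-- Parseval for `(j + 1) * v j`; the weights undo the whitening factors in `cosVec`. Indices start
at `0`, so `j` here stands for level `j + 1` of the statistic. -/
lemma sum_cosVec_smul (k : ℕ) (hk : 1 ≤ k) (v : ℕ → ℝ) :
    ∑ i : Fin (k - 1), limitWeight k (i + 1) * (∑ j ∈ Finset.range k, v j • cosVec k j) i ^ 2 =
      ∑ j ∈ Finset.range k, ((j + 1) * v j - 1 / k * ∑ l ∈ Finset.range k, (l + 1) * v l) ^ 2 := by
  have h := sum_sq_sub_mean_eq_sum_cosBasis k hk fun j => ((j : ℝ) + 1) * v j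
  rw [h]
  refine Finset.sum_congr rfl fun i _ => ?_
  have hl := limitWeight_pos (k := k) (i := i + 1) (by omega) (by have := i.2; omega)
  have e : (∑ j ∈ Finset.range k, v j • cosVec k j) i =
      (√(limitWeight k (i + 1)))⁻¹ *
        ∑ j ∈ Finset.range k, cosBasis k (i + 1) j * ((j + 1) * v j) := by
    rw [WithLp.ofLp_sum, Finset.sum_apply, Finset.mul_sum]
    refine Finset.sum_congr rfl fun j _ => ?_
    simp [cosVec]
    ring
  rw [e, mul_pow, inv_pow, Real.sq_sqrt hl.le, ← mul_assoc, mul_inv_cancel₀ hl.ne', one_mul]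

lemma integral_indicator_mul_indicator {E : Type*} [MeasurableSpace E] {μ : Measure E}
    {A : ℕ → Set E} (hA : ∀ j, MeasurableSet (A j)) (hanti : Antitone A) (j l : ℕ) :
    ∫ x, (A j).indicator (fun _ => (1 : ℝ)) x * (A l).indicator (fun _ => (1 : ℝ)) x ∂μ =
      μ.real (A (max j l)) := by
  have h : ∀ x, (A j).indicator (fun _ => (1 : ℝ)) x * (A l).indicator (fun _ => (1 : ℝ)) x =
      (A (max j l)).indicator (fun _ => (1 : ℝ)) x := by
    intro x
    rcases le_total j l with hjl | hjl
    · rw [max_eq_right hjl]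
      by_cases hx : x ∈ A l
      · simp [hx, hanti hjl hx]
      · simp [hx]
    · rw [max_eq_left hjl]
      by_cases hx : x ∈ A j
      · simp [hx, hanti hjl hx]
      · simp [hx]
  simp_rw [h]
  rw [integral_indicator_const _ (hA _), smul_eq_mul, mul_one]

/-- A bias of order `o(√q)` is in particular `o(q)`; this weaker form suffices for second moments
and for the law of large numbers. -/
lemma tendsto_scaled_prob {E : Type*} [MeasurableSpace E] {μ : Measure E} {M : ℕ → Finset ℕ} {A : ℕ → ℕ → Set E} {q : ℕ → ℝ}
    (hq : Tendsto q atTop atTop)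
    (hp : ∀ j : ℕ, Tendsto (fun n => (((M n).card : ℝ) * μ.real (A n j) - q n / (j + 1)) / √(q n))
      atTop (𝓝 0)) (j : ℕ) :
    Tendsto (fun n => ((M n).card : ℝ) * μ.real (A n j) / q n) atTop (𝓝 (1 / (j + 1))) := by
  have h1 : Tendsto (fun n => (√(q n))⁻¹) atTop (𝓝 0) :=
    (Real.tendsto_sqrt_atTop.comp hq).inv_tendsto_atTop
  have h2 := ((hp j).mul h1).add_const (1 / ((j : ℝ) + 1))
  simp only [mul_zero, zero_add] at h2
  refine h2.congr' ?_
  filter_upwards [hq.eventually_gt_atTop 0] with n hn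
  have hs : √(q n) * √(q n) = q n := Real.mul_self_sqrt hn.le
  rw [← div_eq_mul_inv, div_div, hs]
  field_simp
  ring

section Nested

variable {Ω Ω' E : Type*} [MeasurableSpace Ω] [MeasurableSpace Ω'] [MeasurableSpace E]
  {P : Measure Ω} [IsProbabilityMeasure P] {P' : Measure Ω'} [IsProbabilityMeasure P']
  {μ : Measure E} [IsProbabilityMeasure μ] {X : ℕ → Ω → E}

/-- Central limit theorem for the whitened cosine coefficients of the counts of nested rare
events. -/
lemma tendstoInDistribution_nested_counts (k : ℕ) (hX : ∀ i, HasLaw (X i) μ P)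
    (hindep : iIndepFun X P) {M : ℕ → Finset ℕ} (hM : Tendsto (fun n => (M n).card) atTop atTop)
    {A : ℕ → ℕ → Set E} (hA : ∀ n j, MeasurableSet (A n j)) (hanti : ∀ n, Antitone (A n))
    {q : ℕ → ℝ} (hq : Tendsto q atTop atTop)
    (hp : ∀ j : ℕ, Tendsto (fun n => (((M n).card : ℝ) * μ.real (A n j) - q n / (j + 1)) / √(q n))
      atTop (𝓝 0))
    {ξ : Fin (k - 1) → Ω' → ℝ} (hξ : ∀ i, HasLaw (ξ i) (gaussianReal 0 1) P')
    (hξi : iIndepFun ξ P') :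
    TendstoInDistribution
      (fun n ω => ∑ j ∈ Finset.range k, (hitCount X (M n) (A n j) ω / √(q n)) • cosVec k j) atTop
      (fun ω => WithLp.toLp 2 fun i => ξ i ω) (fun _ => P) P' := by
  let T : ℕ → E → Fin (k - 1) → ℝ := fun n x i =>
    ∑ j ∈ Finset.range k, ((A n j).indicator (fun _ => (1 : ℝ)) x / √(q n)) * cosVec k j i
  have hs0 : Tendsto (fun n => (√(q n))⁻¹) atTop (𝓝 0) :=
    (Real.tendsto_sqrt_atTop.comp hq).inv_tendsto_atTop
  have hind : ∀ n j, Measurable ((A n j).indicator fun _ => (1 : ℝ)) := fun n j =>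
    measurable_const.indicator (hA n j)
  have hindb : ∀ n j x, ‖(A n j).indicator (fun _ => (1 : ℝ)) x‖ ≤ 1 := fun n j x => by
    by_cases h : x ∈ A n j <;> simp [h]
  have hint : ∀ n j, Integrable ((A n j).indicator fun _ => (1 : ℝ)) μ := fun n j =>
    .of_bound (hind n j).aestronglyMeasurable 1 (ae_of_all _ (hindb n j))
  have hint2 : ∀ n j l, Integrable (fun x => (A n j).indicator (fun _ => (1 : ℝ)) x *
      (A n l).indicator (fun _ => (1 : ℝ)) x) μ := fun n j l => by
    refine .of_bound ((hind n j).mul (hind n l)).aestronglyMeasurable 1 (ae_of_all _ fun x => ?_)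
    rw [norm_mul]
    exact mul_le_one₀ (hindb n j x) (norm_nonneg _) (hindb n l x)
  have hT : ∀ n i, Measurable fun x => T n x i := fun n i =>
    Finset.measurable_fun_sum _ fun j _ => ((hind n j).div_const _).mul_const _
  have hTb : ∀ n x i, |T n x i| ≤
      (√(q n))⁻¹ * ∑ i : Fin (k - 1), ∑ j ∈ Finset.range k, |cosVec k j i| := by
    intro n x i
    have h1 : |T n x i| ≤ (√(q n))⁻¹ * ∑ j ∈ Finset.range k, |cosVec k j i| := by
      refine (Finset.abs_sum_le_sum_abs _ _).trans ?_
      rw [Finset.mul_sum]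
      refine Finset.sum_le_sum fun j _ => ?_
      rw [abs_mul, abs_div, abs_of_nonneg (Real.sqrt_nonneg _), div_eq_mul_inv]
      refine mul_le_mul_of_nonneg_right ?_ (abs_nonneg _)
      exact mul_le_of_le_one_left (by positivity) (hindb n j x)
    refine h1.trans (mul_le_mul_of_nonneg_left ?_ (by positivity))
    exact Finset.single_le_sum (f := fun i => ∑ j ∈ Finset.range k, |cosVec k j i|)
      (fun _ _ => Finset.sum_nonneg fun _ _ => abs_nonneg _) (Finset.mem_univ i)
  have hb : Tendsto (fun n => (√(q n))⁻¹ *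
      ∑ i : Fin (k - 1), ∑ j ∈ Finset.range k, |cosVec k j i|) atTop (𝓝 0) := by
    simpa using hs0.mul_const (∑ i : Fin (k - 1), ∑ j ∈ Finset.range k, |cosVec k j i|)
  have hcv : ∀ (i : Fin (k - 1)) (j : ℕ), cosVec k j i =
      (√(limitWeight k (i + 1)))⁻¹ * cosBasis k (i + 1) j * (j + 1) := fun i j => rfl
  have h1 : ∀ i, Tendsto (fun n => ((M n).card : ℝ) * ∫ x, T n x i ∂μ) atTop (𝓝 0) := by
    intro i
    have e : ∀ n, ((M n).card : ℝ) * ∫ x, T n x i ∂μ = ∑ j ∈ Finset.range k,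
        cosVec k j i * ((((M n).card : ℝ) * μ.real (A n j) - q n / (j + 1)) / √(q n)) := by
      intro n
      -- The factor `j + 1` in `cosVec` cancels the denominator, so the leading part of the mean is
      -- a constant vector paired with a cosine vector. Hence the counts need no centring.
      have hz : ∑ j ∈ Finset.range k, cosVec k j i * (q n / (j + 1) / √(q n)) = 0 := by
        have : ∀ j ∈ Finset.range k, cosVec k j i * (q n / (j + 1) / √(q n)) =
            (√(limitWeight k (i + 1)))⁻¹ * (q n / √(q n)) * cosBasis k (i + 1) j := by
          intro j _
          rw [hcv]
          have : (j : ℝ) + 1 ≠ 0 := by positivity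
          field_simp
        rw [Finset.sum_congr rfl this, ← Finset.mul_sum,
          sum_cosBasis (by omega) (by have := i.2; omega), mul_zero]
      simp_rw [sub_div, mul_sub]
      rw [Finset.sum_sub_distrib, hz, sub_zero, integral_finsetSum _ fun j _ =>
        ((hint n j).div_const _).mul_const _, Finset.mul_sum]
      refine Finset.sum_congr rfl fun j _ => ?_
      rw [integral_mul_const, integral_div, integral_indicator_const _ (hA n j), smul_eq_mul]
      ring
    simp_rw [e]
    simpa using tendsto_finsetSum (Finset.range k) fun j _ => (hp j).const_mul (cosVec k j i)
  have h2 : ∀ i l, Tendsto (fun n => ((M n).card : ℝ) * ∫ x, T n x i * T n x l ∂μ) atTop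
      (𝓝 (if i = l then 1 else 0)) := by
    intro i l
    have e : ∀ n, 0 < q n → ∑ j ∈ Finset.range k, ∑ j' ∈ Finset.range k,
        cosVec k j i * cosVec k j' l * (((M n).card : ℝ) * μ.real (A n (max j j')) / q n) =
        ((M n).card : ℝ) * ∫ x, T n x i * T n x l ∂μ := by
      intro n hn
      have h3 : ∀ x, T n x i * T n x l = ∑ j ∈ Finset.range k, ∑ j' ∈ Finset.range k,
          cosVec k j i * cosVec k j' l / q n * ((A n j).indicator (fun _ => (1 : ℝ)) x *
            (A n j').indicator (fun _ => (1 : ℝ)) x) := by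
        intro x
        simp only [T]
        rw [Finset.sum_mul_sum]
        refine Finset.sum_congr rfl fun j _ => Finset.sum_congr rfl fun j' _ => ?_
        have hs : (q n)⁻¹ = (√(q n))⁻¹ * (√(q n))⁻¹ := by rw [← mul_inv, Real.mul_self_sqrt hn.le]
        simp only [div_eq_mul_inv, hs]
        ring
      simp_rw [h3]
      rw [integral_finsetSum _ fun j _ => integrable_finsetSum _ fun j' _ =>
        (hint2 n j j').const_mul _, Finset.mul_sum]
      refine Finset.sum_congr rfl fun j _ => ?_
      rw [integral_finsetSum _ fun j' _ => (hint2 n j j').const_mul _, Finset.mul_sum]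
      refine Finset.sum_congr rfl fun j' _ => ?_
      rw [integral_const_mul, integral_indicator_mul_indicator (hA n) (hanti n)]
      ring
    have hlim := tendsto_finsetSum (Finset.range k) fun j _ =>
      tendsto_finsetSum (Finset.range k) fun j' _ =>
        (tendsto_scaled_prob hq hp (max j j')).const_mul (cosVec k j i * cosVec k j' l)
    have hval : ∑ j ∈ Finset.range k, ∑ j' ∈ Finset.range k,
        cosVec k j i * cosVec k j' l * (1 / (((max j j' : ℕ) : ℝ) + 1)) =
        if i = l then 1 else 0 := by
      have h4 : ∀ j j' : ℕ, cosVec k j i * cosVec k j' l * (1 / (((max j j' : ℕ) : ℝ) + 1)) =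
          (√(limitWeight k (i + 1)))⁻¹ * (√(limitWeight k (l + 1)))⁻¹ *
            (cosBasis k (i + 1) j * cosBasis k (l + 1) j' *
              ((min (j + 1) (j' + 1) : ℕ) : ℝ)) := by
        intro j j'
        rw [hcv, hcv]
        -- The intersection of nested sets contributes `1 / (max j j' + 1)`; the weights `(j + 1)
        -- (j' + 1)` turn it into the random-walk covariance.
        have h5 : ((max j j' : ℕ) + 1 : ℝ) * ((min (j + 1) (j' + 1) : ℕ) : ℝ) =
            (j + 1) * (j' + 1) := by
          rcases le_total j j' with h | h
          · rw [max_eq_right h, min_eq_left (by omega)]; push_cast; ring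
          · rw [max_eq_left h, min_eq_right (by omega)]; push_cast; ring
        have h6 : ((max j j' : ℕ) + 1 : ℝ) ≠ 0 := by positivity
        field_simp
        linear_combination (-((√(limitWeight k (i + 1)))⁻¹ * (√(limitWeight k (l + 1)))⁻¹ *
          cosBasis k (i + 1) j * cosBasis k (l + 1) j')) * h5
      simp_rw [h4, ← Finset.mul_sum]
      rw [sum_min_mul_cosBasis_mul_cosBasis (by omega) (by have := i.2; omega) (by omega)
        (by have := l.2; omega)]
      have hl := limitWeight_pos (k := k) (i := i + 1) (by omega) (by have := i.2; omega)
      by_cases hil : i = l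
      · subst hil
        simp only [if_true]
        rw [← mul_inv, Real.mul_self_sqrt hl.le, inv_mul_cancel₀ hl.ne']
      · have : (i : ℕ) + 1 ≠ l + 1 := fun h => hil (Fin.ext (by omega))
        rw [if_neg hil, if_neg this, mul_zero]
    rw [hval] at hlim
    refine hlim.congr' ?_
    filter_upwards [hq.eventually_gt_atTop 0] with n hn using e n hn
  have key := tendstoInDistribution_sum_stdNormal hX hindep hM hξ hξi hT hTb hb h1 h2
  convert key using 3 with n ω
  ext i
  simp only [WithLp.ofLp_sum, Finset.sum_apply, T, PiLp.smul_apply, smul_eq_mul]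
  rw [Finset.sum_comm]
  refine Finset.sum_congr rfl fun j _ => ?_
  rw [hitCount, Finset.sum_div, Finset.sum_mul]

/-- Limit law of the normalized quadratic statistic of counts which are asymptotically equivalent
to counts of nested rare events. -/
theorem tendstoInDistribution_quadratic_statistic {k : ℕ} (hk : 1 ≤ k)
    (hX : ∀ i, HasLaw (X i) μ P)
    (hindep : iIndepFun X P) {M : ℕ → Finset ℕ} (hM : Tendsto (fun n => (M n).card) atTop atTop)
    {A : ℕ → ℕ → Set E} (hA : ∀ n j, MeasurableSet (A n j)) (hanti : ∀ n, Antitone (A n))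
    {q : ℕ → ℝ} (hq : Tendsto q atTop atTop)
    (hp : ∀ j : ℕ, Tendsto (fun n => (((M n).card : ℝ) * μ.real (A n j) - q n / (j + 1)) / √(q n))
      atTop (𝓝 0))
    {N : ℕ → ℕ → Ω → ℝ} (hN : ∀ n j, AEMeasurable (N n j) P)
    (hNA : ∀ j, TendstoInMeasure P
      (fun n ω => (N n j ω - hitCount X (M n) (A n j) ω) / √(q n)) atTop 0)
    {ξ : Fin (k - 1) → Ω' → ℝ} (hξ : ∀ i, HasLaw (ξ i) (gaussianReal 0 1) P')
    (hξi : iIndepFun ξ P') :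
    TendstoInDistribution
      (fun n ω => (∑ j ∈ Finset.range k, ((j + 1) * N n j ω -
        1 / k * ∑ l ∈ Finset.range k, (l + 1) * N n l ω) ^ 2) /
        (1 / k * ∑ l ∈ Finset.range k, (l + 1) * N n l ω)) atTop
      (fun ω => ∑ i : Fin (k - 1), limitWeight k (i + 1) * ξ i ω ^ 2) (fun _ => P) P' := by
  have hk0 : (0 : ℝ) < k := by exact_mod_cast hk
  have hWm : ∀ n, AEMeasurable (fun ω => ∑ j ∈ Finset.range k, (N n j ω / √(q n)) • cosVec k j) P :=
    fun n => Finset.aemeasurable_fun_sum _ fun j _ => ((hN n j).div_const _).smul_const _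
  have hRm : ∀ n, AEMeasurable (fun ω => 1 / (k : ℝ) *
      ∑ l ∈ Finset.range k, ((l : ℝ) + 1) * N n l ω) P := fun n =>
    (Finset.aemeasurable_fun_sum _ fun l _ => (hN n l).const_mul _).const_mul _
  have hW : TendstoInDistribution
      (fun n ω => ∑ j ∈ Finset.range k, (N n j ω / √(q n)) • cosVec k j) atTop
      (fun ω => WithLp.toLp 2 fun i => ξ i ω) (fun _ => P) P' := by
    refine tendstoInDistribution_of_tendstoInMeasure_sub _ _
      (tendstoInDistribution_nested_counts k hX hindep hM hA hanti hq hp hξ hξi) ?_ hWm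
    refine tendstoInMeasure_zero_of_norm_le_sum (Finset.range k)
      (∑ j ∈ Finset.range k, ‖cosVec k j‖) (Eventually.of_forall fun n ω => ?_) fun j _ => hNA j
    rw [Pi.sub_apply, Pi.sub_apply, ← Finset.sum_sub_distrib, Finset.mul_sum]
    refine (norm_sum_le _ _).trans (Finset.sum_le_sum fun j hj => ?_)
    rw [← sub_smul, norm_smul, mul_comm, ← sub_div, Real.norm_eq_abs]
    exact mul_le_mul_of_nonneg_right
      (Finset.single_le_sum (f := fun j => ‖cosVec k j‖) (fun _ _ => norm_nonneg _) hj)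
      (abs_nonneg _)
  -- Each `(l + 1) * N n l / q n` tends to 1 in measure, hence so does their average.
  have hR : TendstoInMeasure P (fun n ω =>
      (1 / k * ∑ l ∈ Finset.range k, (l + 1) * N n l ω) / q n) atTop fun _ => 1 := by
    have hj : ∀ j : ℕ, TendstoInMeasure P (fun n ω => N n j ω / q n - 1 / (j + 1)) atTop 0 := by
      intro j
      refine tendstoInMeasure_zero_of_norm_le_sum (ι := Bool) (g := fun b => if b then
        (fun n ω => (N n j ω - hitCount X (M n) (A n j) ω) / √(q n)) else
        (fun n ω => hitCount X (M n) (A n j) ω / q n - 1 / (j + 1))) Finset.univ 1 ?_ ?_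
      · filter_upwards [hq.eventually_ge_atTop 1] with n hn ω
        have hs : √(q n) * √(q n) = q n := Real.mul_self_sqrt (by linarith)
        have hs1 : 1 ≤ √(q n) := by rwa [Real.one_le_sqrt]
        simp only [Fintype.sum_bool, if_true, one_mul, Bool.false_eq_true, if_false,
          Real.norm_eq_abs]
        have e : N n j ω / q n - 1 / (j + 1) =
            (N n j ω - hitCount X (M n) (A n j) ω) / √(q n) * (√(q n))⁻¹ +
              (hitCount X (M n) (A n j) ω / q n - 1 / (j + 1)) := by
          rw [← div_eq_mul_inv, div_div, hs]; ring
        rw [e]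
        refine (abs_add_le _ _).trans (add_le_add_left ?_ _)
        rw [abs_mul, abs_of_pos (show 0 < (√(q n))⁻¹ by positivity)]
        exact mul_le_of_le_one_right (abs_nonneg _) (inv_le_one_of_one_le₀ hs1)
      · rintro (_ | _) _
        · exact tendstoInMeasure_hitCount_div hX hindep (fun n => hA n j) hq
            (tendsto_scaled_prob hq hp j)
        · exact hNA j
    have h0 : TendstoInMeasure P (fun n ω =>
        (1 / k * ∑ l ∈ Finset.range k, (l + 1) * N n l ω) / q n - 1) atTop 0 := by
      refine tendstoInMeasure_zero_of_norm_le_sum (Finset.range k) 1 ?_ fun j _ => hj j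
      filter_upwards [hq.eventually_gt_atTop 0] with n hn ω
      have e : (1 / k * ∑ l ∈ Finset.range k, (l + 1) * N n l ω) / q n - 1 =
          ∑ l ∈ Finset.range k, (l + 1) / k * (N n l ω / q n - 1 / (l + 1)) := by
        have h1 : ∀ l ∈ Finset.range k, ((l : ℝ) + 1) / k * (N n l ω / q n - 1 / (l + 1)) =
            (l + 1) * N n l ω * (1 / k / q n) - 1 / k := by
          intro l _
          have : (l : ℝ) + 1 ≠ 0 := by positivity
          field_simp
        rw [Finset.sum_congr rfl h1, Finset.sum_sub_distrib, ← Finset.sum_mul]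
        simp only [Finset.sum_const, Finset.card_range, nsmul_eq_mul]
        field_simp
      rw [e, one_mul, Real.norm_eq_abs]
      refine (Finset.abs_sum_le_sum_abs _ _).trans (Finset.sum_le_sum fun l hl => ?_)
      rw [abs_mul]
      refine mul_le_of_le_one_left (abs_nonneg _) ?_
      have : ((l : ℝ) + 1) ≤ k := by exact_mod_cast Finset.mem_range.mp hl
      rw [abs_of_nonneg (by positivity), div_le_one hk0]
      exact this
    rw [tendstoInMeasure_iff_norm] at h0 ⊢
    simpa using h0
  have hlim := hW.continuous_comp_prodMk_of_tendstoInMeasure_const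
    (g := fun z : EuclideanSpace ℝ (Fin (k - 1)) × ℝ =>
      (∑ i : Fin (k - 1), limitWeight k (i + 1) * z.1 i ^ 2) * z.2) (by fun_prop)
    (TendstoInMeasure.inv_one hR) fun n => ((hRm n).div_const _).inv
  simp only [mul_one] at hlim
  refine tendstoInDistribution_of_tendstoInMeasure_sub _ _ hlim ?_ fun n => ?_
  -- As soon as `q n > 0` the normalisations cancel and the two expressions agree exactly, also
  -- where the denominator is `0`.
  · refine tendstoInMeasure_zero_of_norm_le_sum (ι := Empty) (g := fun e => e.elim) ∅ 0 ?_ (by simp)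
    filter_upwards [hq.eventually_gt_atTop 0] with n hn ω
    rw [zero_mul, norm_le_zero_iff, Pi.sub_apply, Pi.sub_apply, sub_eq_zero, sum_cosVec_smul k hk]
    have h1 : ∀ j ∈ Finset.range k, (((j : ℝ) + 1) * (N n j ω / √(q n)) -
        1 / k * ∑ l ∈ Finset.range k, (l + 1) * (N n l ω / √(q n))) ^ 2 =
        ((j + 1) * N n j ω - 1 / k * ∑ l ∈ Finset.range k, (l + 1) * N n l ω) ^ 2 / q n := by
      intro j _
      have h2 : ∑ l ∈ Finset.range k, ((l : ℝ) + 1) * (N n l ω / √(q n)) =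
          (∑ l ∈ Finset.range k, (l + 1) * N n l ω) / √(q n) := by
        rw [Finset.sum_div]; exact Finset.sum_congr rfl fun _ _ => by ring
      rw [h2]
      nth_rw 3 [← Real.sq_sqrt hn.le]
      rw [← div_pow]
      congr 1
      ring
    rw [Finset.sum_congr rfl h1, ← Finset.sum_div, inv_div, div_mul_div_comm, mul_comm (q n),
      mul_div_mul_right _ _ hn.ne']
  · refine (Finset.aemeasurable_fun_sum _ fun j _ => ?_).div (hRm n)
    exact (((hN n j).const_mul _).sub (hRm n)).pow_const 2

end Nested

/-! ### Marginal quantiles of a law with continuous joint distribution function. -/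

section Marginals

variable {d : ℕ} {μ : Measure (Fin d → ℝ)}

lemma monotone_marginalCDF (r : Fin d) : Monotone (marginalCDF μ r) := monotone_cdf _

lemma nonempty_le_marginalCDF (r : Fin d) {q : ℝ} (hq : q < 1) :
    {t | q ≤ marginalCDF μ r t}.Nonempty := by
  have := (tendsto_cdf_atTop (μ.map fun x => x r)).eventually_const_lt hq
  obtain ⟨t, ht⟩ := this.exists
  exact ⟨t, ht.le⟩

lemma bddBelow_le_marginalCDF (r : Fin d) {q : ℝ} (hq : 0 < q) :
    BddBelow {t | q ≤ marginalCDF μ r t} := by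
  have := (tendsto_cdf_atBot (μ.map fun x => x r)).eventually_lt_const hq
  obtain ⟨t, ht⟩ := this.exists
  refine ⟨t, fun s hs => ?_⟩
  by_contra! h
  exact absurd (hs.trans (monotone_marginalCDF r h.le)) (not_le.mpr ht)

lemma genInv_marginalCDF_mono (r : Fin d) {q q' : ℝ} (hq : 0 < q) (hqq : q ≤ q') (hq' : q' < 1) :
    genInv (marginalCDF μ r) q ≤ genInv (marginalCDF μ r) q' :=
  csInf_le_csInf (bddBelow_le_marginalCDF r hq) (nonempty_le_marginalCDF r hq')
    fun _ ht => hqq.trans ht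

variable (μ) in
/-- The points exceeding the marginal quantile of level `1 - p` in at least one component. -/
def exceedSet (p : ℝ) : Set (Fin d → ℝ) :=
  {x | ∃ r, genInv (marginalCDF μ r) (1 - p) < x r}

lemma exceedSet_eq_compl (p : ℝ) :
    exceedSet μ p = (Set.Iic fun r => genInv (marginalCDF μ r) (1 - p))ᶜ := by
  ext x; simp [exceedSet, Pi.le_def]

lemma measurableSet_exceedSet (p : ℝ) : MeasurableSet (exceedSet μ p) := by
  rw [exceedSet_eq_compl]; exact measurableSet_Iic.compl

lemma exceedSet_mono {p p' : ℝ} (hp : 0 < p) (hpp : p ≤ p') (hp' : p' < 1) :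
    exceedSet μ p ⊆ exceedSet μ p' := fun _ ⟨r, hr⟩ =>
  ⟨r, (genInv_marginalCDF_mono r (by linarith) (by linarith) (by linarith)).trans_lt hr⟩

variable [IsProbabilityMeasure μ]

lemma marginalCDF_eq (r : Fin d) (t : ℝ) : marginalCDF μ r t = μ.real {x | x r ≤ t} := by
  have : IsProbabilityMeasure (μ.map fun x => x r) :=
    Measure.isProbabilityMeasure_map (measurable_pi_apply r).aemeasurable
  rw [marginalCDF, cdf_eq_real, map_measureReal_apply (measurable_pi_apply r) measurableSet_Iic]
  rfl

lemma measurableSet_coord_le (r : Fin d) (t : ℝ) : MeasurableSet {x : Fin d → ℝ | x r ≤ t} :=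
  measurableSet_le (measurable_pi_apply r) measurable_const

lemma tendsto_jointCDF_const :
    Tendsto (fun N : ℕ => jointCDF μ fun _ => (N : ℝ)) atTop (𝓝 1) := by
  have hmono : Monotone fun N : ℕ => Set.Iic (fun _ : Fin d => (N : ℝ)) := fun a b hab =>
    Set.Iic_subset_Iic.mpr fun _ => Nat.cast_le.mpr hab
  have hU : ⋃ N : ℕ, Set.Iic (fun _ : Fin d => (N : ℝ)) = Set.univ := by
    refine Set.eq_univ_of_forall fun x => Set.mem_iUnion.mpr ?_
    obtain ⟨N, hN⟩ := exists_nat_ge (∑ r, |x r|)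
    refine ⟨N, fun r => (le_abs_self _).trans (le_trans ?_ hN)⟩
    exact Finset.single_le_sum (f := fun r => |x r|) (fun _ _ => abs_nonneg _) (Finset.mem_univ r)
  have h := tendsto_measure_iUnion_atTop (μ := μ) hmono
  rw [hU, measure_univ] at h
  have := (ENNReal.tendsto_toReal ENNReal.one_ne_top).comp h
  simpa [jointCDF, Measure.real, Function.comp_def] using this

/-- The marginal is a uniform limit of continuous sections of the joint distribution function: with
all other coordinates set to `N`, the error is at most the mass outside `Set.Iic (N, …, N)`,
whatever `t` is. -/
lemma continuous_marginalCDF (hF : Continuous (jointCDF μ)) (r : Fin d) :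
    Continuous (marginalCDF μ r) := by
  have hunif : TendstoUniformly
      (fun (N : ℕ) t => jointCDF μ (Function.update (fun _ => (N : ℝ)) r t))
      (marginalCDF μ r) atTop := by
    rw [Metric.tendstoUniformly_iff]
    intro ε hε
    have h1 := (tendsto_jointCDF_const (μ := μ)).eventually_const_lt
      (show 1 - ε < 1 by linarith)
    filter_upwards [h1] with N hN t
    set y : Fin d → ℝ := Function.update (fun _ => (N : ℝ)) r t
    have hy : Set.Iic y ⊆ {x | x r ≤ t} := fun x hx => by
      have := hx r
      simpa [y] using this
    have hsub : {x : Fin d → ℝ | x r ≤ t} \ Set.Iic y ⊆ (Set.Iic fun _ => (N : ℝ))ᶜ := by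
      rintro x ⟨hx1, hx2⟩ hx3
      refine hx2 fun s => ?_
      by_cases hs : s = r
      · subst hs; simpa [y] using hx1
      · simpa [y, hs] using hx3 s
    have h2 := measureReal_sdiff (μ := μ) hy measurableSet_Iic
    have h3 := measureReal_mono (μ := μ) hsub
    rw [h2, probReal_compl_eq_one_sub measurableSet_Iic, ← marginalCDF_eq] at h3
    have h4 : 0 ≤ marginalCDF μ r t - μ.real (Set.Iic y) := by
      rw [marginalCDF_eq, sub_nonneg]; exact measureReal_mono hy
    rw [Real.dist_eq, jointCDF, abs_of_nonneg h4]
    refine h3.trans_lt ?_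
    have : 1 - ε < μ.real (Set.Iic fun _ => (N : ℝ)) := hN
    linarith
  refine hunif.continuous (Frequently.of_forall fun N => hF.comp ?_)
  exact continuous_const.update r continuous_id

lemma marginalCDF_genInv (hF : Continuous (jointCDF μ)) (r : Fin d) {q : ℝ} (hq : 0 < q)
    (hq' : q < 1) : marginalCDF μ r (genInv (marginalCDF μ r) q) = q := by
  have hc := continuous_marginalCDF hF r
  have hb := bddBelow_le_marginalCDF (μ := μ) r hq
  refine le_antisymm ?_ ?_
  · have h0 := (tendsto_cdf_atBot (μ.map fun x => x r)).eventually_lt_const hq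
    obtain ⟨t, ht⟩ := h0.exists
    obtain ⟨s, hs⟩ := nonempty_le_marginalCDF (μ := μ) r hq'
    obtain ⟨u, hu⟩ := mem_range_of_exists_le_of_exists_ge hc ⟨t, ht.le⟩ ⟨s, hs⟩
    calc _ ≤ marginalCDF μ r u := monotone_marginalCDF r (csInf_le hb hu.ge)
      _ = q := hu
  · exact (isClosed_le continuous_const hc).csInf_mem (nonempty_le_marginalCDF r hq') hb

lemma measureReal_between_genInv (hF : Continuous (jointCDF μ)) (r : Fin d) {q q' : ℝ}
    (hq : 0 < q) (hqq : q ≤ q') (hq' : q' < 1) :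
    μ.real {x | genInv (marginalCDF μ r) q < x r ∧ x r ≤ genInv (marginalCDF μ r) q'} =
      q' - q := by
  have hset : {x : Fin d → ℝ | genInv (marginalCDF μ r) q < x r ∧
      x r ≤ genInv (marginalCDF μ r) q'} =
      {x | x r ≤ genInv (marginalCDF μ r) q'} \ {x | x r ≤ genInv (marginalCDF μ r) q} := by
    ext x; simp [and_comm]
  have hsub : {x : Fin d → ℝ | x r ≤ genInv (marginalCDF μ r) q} ⊆
      {x | x r ≤ genInv (marginalCDF μ r) q'} := fun x hx =>
    le_trans hx (genInv_marginalCDF_mono r hq hqq hq')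
  rw [hset, measureReal_sdiff hsub (measurableSet_coord_le r _), ← marginalCDF_eq,
    ← marginalCDF_eq, marginalCDF_genInv hF r (hq.trans_le hqq) hq',
    marginalCDF_genInv hF r hq (hqq.trans_lt hq')]

lemma measureReal_exceedSet (p : ℝ) : μ.real (exceedSet μ p) = 1 - copulaOf μ fun _ => 1 - p := by
  rw [exceedSet_eq_compl, probReal_compl_eq_one_sub measurableSet_Iic]
  rfl

end Marginals

/-! ### Bias of the exceedance probabilities and choice of the bandwidth. -/

/-- Rate of the expected number of exceedances under the `δ`-neighborhood condition. -/
lemma exists_tendsto_exceed_rate {d : ℕ} (hd : 1 ≤ d) {μ : Measure (Fin d → ℝ)}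
    [IsProbabilityMeasure μ] {δ : ℝ} (hδ : 0 < δ) (hC : InDeltaNeighborhood (copulaOf μ) δ)
    {m c : ℕ → ℝ} (hc : ∀ n, c n ∈ Set.Ioo (0 : ℝ) 1)
    (hc0 : Tendsto c atTop (𝓝 0)) (hmc : Tendsto (fun n => m n * c n) atTop atTop)
    (hmcδ : Tendsto (fun n => m n * c n ^ (1 + 2 * δ)) atTop (𝓝 0)) :
    ∃ a : ℝ, 0 < a ∧ ∀ j : ℕ, Tendsto (fun n =>
      (m n * μ.real (exceedSet μ (c n / (j + 1))) - m n * c n * a / (j + 1)) /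
        √(m n * c n * a)) atTop (𝓝 0) := by
  obtain ⟨D, hD, hO⟩ := hC
  have ha : 0 < D 1 := by
    refine lt_of_le_of_ne (apply_nonneg D _) fun h => ?_
    have h1 := congrFun (hD 1 h.symm) ⟨0, hd⟩
    simp at h1
  -- On the diagonal, `u = (1 - p, …, 1 - p)` has `D (u - 1) = p * D 1`, so the exceedance
  -- probability is `p * D 1` to first order.
  refine ⟨D 1, ha, fun j => ?_⟩
  have hj : (1 : ℝ) ≤ (j : ℝ) + 1 := by linarith [Nat.cast_nonneg (α := ℝ) j]
  have hu : Tendsto (fun n (_ : Fin d) => 1 - c n / (j + 1)) atTop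
      (𝓝[Set.univ.pi fun _ => Set.Ioo (0 : ℝ) 1] (1 : Fin d → ℝ)) := by
    rw [tendsto_nhdsWithin_iff]
    constructor
    · rw [tendsto_pi_nhds]
      intro r
      simpa using (hc0.div_const ((j : ℝ) + 1)).const_sub 1
    · refine Eventually.of_forall fun n r _ => ?_
      have h1 : 0 < c n / (j + 1) := div_pos (hc n).1 (by linarith)
      have h2 : c n / (j + 1) ≤ c n := div_le_self (hc n).1.le hj
      have h3 := (hc n).2
      constructor <;> simp only <;> linarith
  obtain ⟨K, hK0, hK⟩ := (hO.comp_tendsto hu).exists_pos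
  have hnorm : ∀ n, D ((fun _ : Fin d => 1 - c n / (j + 1)) - 1) = c n / (j + 1) * D 1 := by
    intro n
    have h1 : (fun _ : Fin d => 1 - c n / ((j : ℝ) + 1)) - 1 = (-(c n / (j + 1))) • (1 : Fin d → ℝ) := by
      ext r; simp
    have h2 : 0 < c n / (j + 1) := div_pos (hc n).1 (by linarith)
    rw [h1, map_smul_eq_mul, norm_neg, Real.norm_eq_abs, abs_of_pos h2]
  set a := D 1
  have hlim : Tendsto (fun n => K * √(m n * c n ^ (1 + 2 * δ) * a ^ (1 + 2 * δ))) atTop (𝓝 0) := by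
    have h1 := hmcδ.mul_const (a ^ (1 + 2 * δ))
    rw [zero_mul] at h1
    have h2 := ((Real.continuous_sqrt.tendsto _).comp h1).const_mul K
    simpa using h2
  refine squeeze_zero_norm' ?_ hlim
  filter_upwards [hK.bound, hmc.eventually_gt_atTop 0] with n hn hmcn
  simp only [Function.comp_apply, hnorm] at hn
  have hcn := (hc n).1
  have hp0 : 0 ≤ c n / (j + 1) * a := by positivity
  have hmn : 0 < m n := pos_of_mul_pos_left hmcn hcn.le
  have h1 : |μ.real (exceedSet μ (c n / (j + 1))) - c n * a / (j + 1)| ≤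
      K * (c n * a) ^ (1 + δ) := by
    rw [measureReal_exceedSet, abs_sub_comm]
    rw [Real.norm_eq_abs, Real.norm_eq_abs, abs_of_nonneg (Real.rpow_nonneg hp0 _)] at hn
    have h2 : (c n / (j + 1) * a) ^ (1 + δ) ≤ (c n * a) ^ (1 + δ) := by
      refine Real.rpow_le_rpow hp0 ?_ (by linarith)
      exact mul_le_mul_of_nonneg_right (div_le_self hcn.le hj) ha.le
    refine le_trans (le_of_eq ?_) (hn.trans (mul_le_mul_of_nonneg_left h2 hK0.le))
    congr 1; ring
  have hy : 0 < c n * a := by positivity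
  -- Dividing the bias by `√(m c a)` leaves the square root of `m (c a)^(1+2δ)`: this is where the
  -- exponent `1 + 2δ` comes from.
  have hsq : m n * (c n * a) ^ (1 + δ) = √(m n * c n ^ (1 + 2 * δ) * a ^ (1 + 2 * δ)) *
      √(m n * c n * a) := by
    rw [← Real.sqrt_mul (by positivity), mul_assoc (m n) _ (a ^ _),
      ← Real.mul_rpow hcn.le ha.le, mul_assoc (m n) (c n) a]
    have h3 : m n * (c n * a) ^ (1 + 2 * δ) * (m n * (c n * a)) =
        (m n * (c n * a) ^ (1 + δ)) ^ 2 := by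
      have h4 : (c n * a) ^ (1 + 2 * δ) * (c n * a) = ((c n * a) ^ (1 + δ)) ^ 2 := by
        rw [← Real.rpow_add_one hy.ne', ← Real.rpow_mul_natCast hy.le]
        congr 1; push_cast; ring
      rw [mul_pow, ← h4]; ring
    rw [h3, Real.sqrt_sq (by positivity)]
  have hs : 0 < √(m n * c n * a) := Real.sqrt_pos.mpr (by positivity)
  rw [Real.norm_eq_abs, abs_div, abs_of_pos hs, div_le_iff₀ hs, mul_assoc K, ← hsq]
  have h5 : m n * μ.real (exceedSet μ (c n / (j + 1))) - m n * c n * a / (j + 1) =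
      m n * (μ.real (exceedSet μ (c n / (j + 1))) - c n * a / (j + 1)) := by ring
  rw [h5, abs_mul, abs_of_pos hmn]
  calc _ ≤ m n * (K * (c n * a) ^ (1 + δ)) := by gcongr
    _ = _ := by ring

/-- Bandwidth for localizing the empirical quantiles. -/
lemma exists_bandwidth {m c : ℕ → ℝ} (hc : ∀ n, 0 < c n)
    (hmn : Tendsto (fun n : ℕ => m n / n) atTop (𝓝 0))
    (hmc : Tendsto (fun n => m n * c n) atTop atTop) :
    ∃ s : ℕ → ℝ, (∀ᶠ n in atTop, 0 < s n) ∧ Tendsto s atTop (𝓝 0) ∧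
      Tendsto (fun n : ℕ => 1 / (n * c n * s n ^ 2)) atTop (𝓝 0) ∧
      Tendsto (fun n => √(m n * c n) * s n) atTop (𝓝 0) := by
  have hle : ∀ᶠ n : ℕ in atTop, m n ≤ n := by
    filter_upwards [hmn.eventually_le_const zero_lt_one, eventually_gt_atTop 0] with n hn hn0
    rwa [div_le_one (by exact_mod_cast hn0)] at hn
  have hroot := (Real.continuous_sqrt.tendsto _).comp hmn
  have hroot2 := (Real.continuous_sqrt.tendsto _).comp hroot
  simp only [Real.sqrt_zero] at hroot hroot2
  -- With `s = (m c · n c)^(-1/4)` the last two quantities are exactly `(m/n)^(1/2)` and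
  -- `(m/n)^(1/4)`.
  refine ⟨fun n => (√√(m n * c n * (n * c n)))⁻¹, ?_, ?_, ?_, ?_⟩
  · filter_upwards [hmc.eventually_gt_atTop 0, eventually_gt_atTop 0] with n hn hn0
    have : (0 : ℝ) < n := by exact_mod_cast hn0
    have := hc n
    positivity
  · refine Tendsto.inv_tendsto_atTop (Real.tendsto_sqrt_atTop.comp (Real.tendsto_sqrt_atTop.comp ?_))
    refine hmc.atTop_mul_atTop₀ (tendsto_atTop_mono' _ ?_ hmc)
    filter_upwards [hle] with n hn
    exact mul_le_mul_of_nonneg_right hn (hc n).le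
  · refine hroot.congr' ?_
    filter_upwards [hmc.eventually_gt_atTop 0, eventually_gt_atTop 0] with n hn hn0
    have h0 : (0 : ℝ) < n := by exact_mod_cast hn0
    have h1 := hc n
    have hm0 : 0 < m n := pos_of_mul_pos_left hn h1.le
    rw [Function.comp_apply, inv_pow, Real.sq_sqrt (Real.sqrt_nonneg _)]
    have e : m n * c n * (n * c n) = m n / n * (n * c n) ^ 2 := by field_simp
    rw [e, Real.sqrt_mul (by positivity), Real.sqrt_sq (by positivity)]
    field_simp
  · refine hroot2.congr' ?_
    filter_upwards [hmc.eventually_gt_atTop 0, eventually_gt_atTop 0] with n hn hn0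
    have h0 : (0 : ℝ) < n := by exact_mod_cast hn0
    have h1 := hc n
    have hm0 : 0 < m n := pos_of_mul_pos_left hn h1.le
    rw [Function.comp_apply, Function.comp_apply, ← div_eq_mul_inv, eq_div_iff (by positivity),
      ← Real.sqrt_mul (Real.sqrt_nonneg _), ← Real.sqrt_mul (by positivity)]
    have e : m n / n * (m n * c n * (n * c n)) = (m n * c n) ^ 2 := by field_simp
    rw [e, Real.sqrt_sq (by positivity)]

/-! ### Empirical quantiles as conditions on counts. -/

section Empirical

variable {d : ℕ}

/-- An observation exceeds the empirical quantile of level `q` if and only if the proportion of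
strictly smaller observations is at least `q`. -/
lemma genInv_empCDF_lt_iff (x : ℕ → Fin d → ℝ) {n : ℕ} (hn : 1 ≤ n) (r : Fin d) {q : ℝ}
    (hq : 0 < q) (hq1 : q ≤ 1) (y : ℝ) :
    genInv (empCDF x n r) q < y ↔
      q ≤ (n : ℝ)⁻¹ * ∑ i ∈ Finset.Icc 1 n, (Set.Iio y).indicator (fun _ => (1 : ℝ)) (x i r) := by
  have hn0 : (n : ℝ) ≠ 0 := by exact_mod_cast (by omega : n ≠ 0)
  have hbdd : BddBelow {t | q ≤ empCDF x n r t} := by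
    obtain ⟨L, hL⟩ := ((Finset.Icc 1 n).image fun i => x i r).bddBelow
    refine ⟨L, fun t ht => ?_⟩
    by_contra! htL
    have h0 : empCDF x n r t = 0 := by
      unfold empCDF
      rw [Finset.sum_eq_zero fun i hi => ?_, mul_zero]
      refine Set.indicator_of_notMem (fun h => ?_) _
      have := hL (Finset.mem_coe.mpr (Finset.mem_image_of_mem (fun i => x i r) hi))
      exact absurd (lt_of_le_of_lt h htL) (not_lt.mpr this)
    have : q ≤ 0 := h0 ▸ ht
    linarith
  constructor
  · intro h
    have hne : {t | q ≤ empCDF x n r t}.Nonempty := by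
      obtain ⟨U, hU⟩ := ((Finset.Icc 1 n).image fun i => x i r).bddAbove
      refine ⟨U, ?_⟩
      have h1 : empCDF x n r U = 1 := by
        unfold empCDF
        rw [Finset.sum_congr rfl fun i hi => Set.indicator_of_mem (s := Set.Iic U)
          (hU (Finset.mem_coe.mpr (Finset.mem_image_of_mem (fun i => x i r) hi))) _]
        simp [hn0]
      rwa [Set.mem_ofPred_eq, h1]
    obtain ⟨t, ht, hty⟩ := exists_lt_of_csInf_lt hne h
    refine le_trans (show q ≤ empCDF x n r t from ht) ?_
    unfold empCDF
    refine mul_le_mul_of_nonneg_left (Finset.sum_le_sum fun i _ => ?_) (by positivity)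
    exact Set.indicator_le_indicator_of_subset (Set.Iic_subset_Iio.mpr hty)
      (fun _ => zero_le_one) _
  · intro h
    have hT : ((Finset.Icc 1 n).filter fun i => x i r < y).Nonempty := by
      by_contra hemp
      rw [Finset.not_nonempty_iff_eq_empty, Finset.filter_eq_empty_iff] at hemp
      rw [Finset.sum_eq_zero fun i hi =>
        Set.indicator_of_notMem (s := Set.Iio y) (hemp hi) _, mul_zero] at h
      linarith
    -- The largest observation below `y` lies in the set whose infimum is the quantile, and it is
    -- strictly below `y`.
    obtain ⟨i₀, hi₀, hmax⟩ := Finset.exists_max_image _ (fun i => x i r) hT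
    rw [Finset.mem_filter] at hi₀
    refine lt_of_le_of_lt (csInf_le hbdd ?_) hi₀.2
    refine le_trans h ?_
    unfold empCDF
    refine mul_le_mul_of_nonneg_left (Finset.sum_le_sum fun i hi => ?_) (by positivity)
    by_cases hiy : x i r < y
    · have : x i r ≤ x i₀ r := hmax i (Finset.mem_filter.mpr ⟨hi, hiy⟩)
      rw [Set.indicator_of_mem (s := Set.Iio y) hiy, Set.indicator_of_mem (s := Set.Iic _) this]
    · rw [Set.indicator_of_notMem (s := Set.Iio y) hiy]
      exact Set.indicator_nonneg (fun _ _ => zero_le_one) _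

lemma exceed_level_mem {c : ℝ} (hc : c ∈ Set.Ioo (0 : ℝ) 1) (j : ℕ) :
    0 < 1 - c / ((j + 1 : ℕ) : ℝ) ∧ 1 - c / ((j + 1 : ℕ) : ℝ) ≤ 1 := by
  have hj : (1 : ℝ) ≤ ((j + 1 : ℕ) : ℝ) := by exact_mod_cast Nat.le_add_left 1 j
  have h1 : c / ((j + 1 : ℕ) : ℝ) ≤ c := div_le_self hc.1.le hj
  have h2 : 0 < c / ((j + 1 : ℕ) : ℝ) := div_pos hc.1 (by linarith)
  have h3 := hc.2
  constructor <;> linarith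

lemma hatCount_eq_sum (x : ℕ → Fin d → ℝ) (n : ℕ) (M : Finset ℕ) (j : ℕ) (c : ℝ) :
    (hatCount x n M j c : ℝ) = ∑ i ∈ M,
      {y : Fin d → ℝ | ∃ r, genInv (empCDF x n r) (1 - c / j) < y r}.indicator
        (fun _ => (1 : ℝ)) (x i) := by
  classical
  unfold hatCount
  rw [Finset.card_filter]
  push_cast
  refine Finset.sum_congr rfl fun i _ => ?_
  rw [Set.indicator_apply]
  rfl

/-- `genInv_empCDF_lt_iff` replaces the infimum by finitely many comparisons of coordinates. -/
lemma measurable_hatCount {n : ℕ} {M : Finset ℕ} (hM : M ⊆ Finset.Icc 1 n) (j : ℕ) {c : ℝ}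
    (hc : c ∈ Set.Ioo (0 : ℝ) 1) :
    Measurable fun x : ℕ → Fin d → ℝ => (hatCount x n M (j + 1) c : ℝ) := by
  classical
  obtain ⟨h0, h1⟩ := exceed_level_mem hc j
  simp_rw [hatCount_eq_sum]
  refine Finset.measurable_fun_sum _ fun i hi => ?_
  have hn : 1 ≤ n := by
    have := Finset.mem_Icc.mp (hM hi)
    omega
  simp_rw [Set.indicator_apply, Set.mem_ofPred_eq, genInv_empCDF_lt_iff _ hn _ h0 h1]
  refine Measurable.ite ?_ measurable_const measurable_const
  simp only [Set.ofPred_exists]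
  refine MeasurableSet.iUnion fun r => measurableSet_le measurable_const ?_
  refine (Finset.measurable_fun_sum _ fun i' _ => ?_).const_mul _
  simp_rw [Set.indicator_apply, Set.mem_Iio]
  exact Measurable.ite (measurableSet_lt (by fun_prop) (by fun_prop)) measurable_const
    measurable_const

end Empirical

/-! ### Replacing empirical by true quantiles. -/

/-- The heights `b n` are arbitrary, so on events of vanishing probability even a diverging bound on
the count error does no harm. -/
lemma tendstoInMeasure_indicator_const {Ω : Type*} [MeasurableSpace Ω] {P : Measure Ω}
    [IsFiniteMeasure P] {G : ℕ → Set Ω} (hG : Tendsto (fun n => P.real (G n)) atTop (𝓝 0))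
    (b : ℕ → ℝ) : TendstoInMeasure P (fun n => (G n).indicator fun _ => b n) atTop 0 := by
  rw [tendstoInMeasure_iff_measureReal_norm]
  intro ε hε
  refine squeeze_zero (fun _ => measureReal_nonneg) (fun n => measureReal_mono fun ω hω => ?_) hG
  by_contra h
  rw [Set.mem_ofPred_eq, Set.indicator_of_notMem h] at hω
  simp at hω
  linarith

section Quantiles

variable {Ω : Type*} {d : ℕ} {μ : Measure (Fin d → ℝ)} {X : ℕ → Ω → Fin d → ℝ}

lemma empCDF_eq_hitCount (X : ℕ → Ω → Fin d → ℝ) (n : ℕ) (r : Fin d) (t : ℝ) (ω : Ω) :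
    empCDF (fun i => X i ω) n r t =
      (n : ℝ)⁻¹ * hitCount X (Finset.Icc 1 n) {x | x r ≤ t} ω := rfl

/-- The event that the empirical distribution function is not sandwiched at the marginal quantiles
of levels `q ± ε`. -/
def badEvent (μ : Measure (Fin d → ℝ)) (X : ℕ → Ω → Fin d → ℝ) (n : ℕ) (r : Fin d) (q ε : ℝ) :
    Set Ω :=
  {ω | empCDF (fun i => X i ω) n r (genInv (marginalCDF μ r) (q + ε)) < q ∨
    q ≤ empCDF (fun i => X i ω) n r (genInv (marginalCDF μ r) (q - ε))}

/-- Outside of the bad events, replacing the true by the empirical quantiles changes the count by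
at most the number of observations with a component between neighbouring quantiles. -/
lemma abs_hatCount_sub_hitCount_le {n : ℕ} {M : Finset ℕ} (hM : M ⊆ Finset.Icc 1 n) {c : ℝ}
    (hc : c ∈ Set.Ioo (0 : ℝ) 1) (j : ℕ) {ε : ℝ} (hε : 0 < ε)
    (h0 : 0 < 1 - c / (j + 1) - ε) (h1 : 1 - c / (j + 1) + ε < 1) (ω : Ω)
    (hω : ∀ r, ω ∉ badEvent μ X n r (1 - c / (j + 1)) ε) :
    |(hatCount (fun i => X i ω) n M (j + 1) c : ℝ) - hitCount X M (exceedSet μ (c / (j + 1))) ω| ≤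
      ∑ r, hitCount X M {x | genInv (marginalCDF μ r) (1 - c / (j + 1) - ε) < x r ∧
        x r ≤ genInv (marginalCDF μ r) (1 - c / (j + 1) + ε)} ω := by
  obtain ⟨hq0, hq1⟩ := exceed_level_mem hc j
  rw [hatCount_eq_sum, hitCount, ← Finset.sum_sub_distrib]
  push_cast at hq0 hq1 ⊢
  set q := 1 - c / ((j : ℝ) + 1)
  refine (Finset.abs_sum_le_sum_abs _ _).trans ?_
  unfold hitCount
  rw [Finset.sum_comm]
  refine Finset.sum_le_sum fun i hi => ?_
  have hn : 1 ≤ n := by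
    have := Finset.mem_Icc.mp (hM hi)
    omega
  have hn0 : (0 : ℝ) ≤ (n : ℝ)⁻¹ := by positivity
  set B : Fin d → Set (Fin d → ℝ) := fun r => {x | genInv (marginalCDF μ r) (q - ε) < x r ∧
        x r ≤ genInv (marginalCDF μ r) (q + ε)}
  have hnonneg : ∀ r, 0 ≤ (B r).indicator (fun _ => (1 : ℝ)) (X i ω) := fun r =>
    Set.indicator_nonneg (fun _ _ => zero_le_one) _
  have hone : ∀ r, X i ω ∈ B r → 1 ≤ ∑ r, (B r).indicator (fun _ => (1 : ℝ)) (X i ω) := by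
    intro r hr
    refine le_trans (le_of_eq ?_) (Finset.single_le_sum (fun r _ => hnonneg r) (Finset.mem_univ r))
    rw [Set.indicator_of_mem hr]
  have hbad : ∀ r, q ≤ empCDF (fun i => X i ω) n r (genInv (marginalCDF μ r) (q + ε)) ∧
      empCDF (fun i => X i ω) n r (genInv (marginalCDF μ r) (q - ε)) < q := fun r => by
    have := hω r
    simpa [badEvent, not_or] using this
  -- If the two criteria disagree on an observation, some coordinate lies between the empirical and
  -- the true quantile, hence in the window `B r`.
  by_cases ha : X i ω ∈ {y : Fin d → ℝ | ∃ r, genInv (empCDF (fun i => X i ω) n r) q < y r} <;>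
    by_cases hb : X i ω ∈ exceedSet μ (c / (j + 1))
  · rw [Set.indicator_of_mem ha, Set.indicator_of_mem hb, sub_self, abs_zero]
    exact Finset.sum_nonneg fun r _ => hnonneg r
  · rw [Set.indicator_of_mem ha, Set.indicator_of_notMem hb, sub_zero, abs_one]
    obtain ⟨r, hr⟩ := ha
    refine hone r ⟨?_, ?_⟩
    · by_contra! hle
      rw [genInv_empCDF_lt_iff _ hn r hq0 hq1] at hr
      refine absurd ((hr.trans ?_).trans_lt (hbad r).2) (lt_irrefl _)
      unfold empCDF
      refine mul_le_mul_of_nonneg_left (Finset.sum_le_sum fun i' _ => ?_) hn0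
      exact Set.indicator_le_indicator_of_subset
        (Set.Iio_subset_Iic_self.trans (Set.Iic_subset_Iic.mpr hle)) (fun _ => zero_le_one) _
    · by_contra! hlt
      refine hb ⟨r, lt_of_le_of_lt ?_ hlt⟩
      exact genInv_marginalCDF_mono r hq0 (by linarith) h1
  · rw [Set.indicator_of_notMem ha, Set.indicator_of_mem hb, zero_sub, abs_neg, abs_one]
    obtain ⟨r, hr⟩ := hb
    refine hone r ⟨lt_of_le_of_lt ?_ hr, ?_⟩
    · exact genInv_marginalCDF_mono r h0 (by linarith) (by linarith)
    · by_contra! hlt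
      refine ha ⟨r, ?_⟩
      rw [genInv_empCDF_lt_iff _ hn r hq0 hq1]
      refine (hbad r).1.trans ?_
      unfold empCDF
      refine mul_le_mul_of_nonneg_left (Finset.sum_le_sum fun i' _ => ?_) hn0
      exact Set.indicator_le_indicator_of_subset (Set.Iic_subset_Iio.mpr hlt)
        (fun _ => zero_le_one) _
  · rw [Set.indicator_of_notMem ha, Set.indicator_of_notMem hb, sub_self, abs_zero]
    exact Finset.sum_nonneg fun r _ => hnonneg r

lemma abs_hatCount_sub_hitCount_le_card (M : Finset ℕ) (n j : ℕ) (c : ℝ) (A : Set (Fin d → ℝ))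
    (ω : Ω) : |(hatCount (fun i => X i ω) n M j c : ℝ) - hitCount X M A ω| ≤ M.card := by
  rw [hatCount_eq_sum, hitCount, ← Finset.sum_sub_distrib]
  refine (Finset.abs_sum_le_sum_abs _ _).trans ?_
  refine (Finset.sum_le_card_nsmul _ _ 1 fun i _ => ?_).trans (by simp)
  have hind : ∀ s : Set (Fin d → ℝ), 0 ≤ s.indicator (fun _ => (1 : ℝ)) (X i ω) ∧
      s.indicator (fun _ => (1 : ℝ)) (X i ω) ≤ 1 := fun s =>
    ⟨Set.indicator_nonneg (fun _ _ => zero_le_one) _, Set.indicator_le_self' (by simp) _⟩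
  obtain ⟨h1, h2⟩ := hind {y | ∃ r, genInv (empCDF (fun i => X i ω) n r) (1 - c / j) < y r}
  obtain ⟨h3, h4⟩ := hind A
  exact abs_le.mpr ⟨by linarith, by linarith⟩

variable [MeasurableSpace Ω] {P : Measure Ω} [IsProbabilityMeasure P] [IsProbabilityMeasure μ]

/-- Chebyshev at the two window endpoints. Bounding each variance by its upper-tail mass keeps the
factor `1 - q`, which is small for extreme quantiles; the two tails add up to `2 (1 - q)`. -/
lemma measureReal_badEvent_le (hF : Continuous (jointCDF μ)) (hX : ∀ i, HasLaw (X i) μ P)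
    (hindep : iIndepFun X P) {n : ℕ} (hn : 1 ≤ n) (r : Fin d) {q ε : ℝ} (hε : 0 < ε)
    (h0 : 0 < q - ε) (h1 : q + ε < 1) :
    P.real (badEvent μ X n r q ε) ≤ 3 * (1 - q) / (n * ε ^ 2) := by
  have hn0 : (0 : ℝ) < n := by exact_mod_cast hn
  have hdev : ∀ t, P.real {ω | n * ε ≤
      |hitCount X (Finset.Icc 1 n) {x | x r ≤ t} ω - n * marginalCDF μ r t|} ≤
      (1 - marginalCDF μ r t) / (n * ε ^ 2) := by
    intro t
    have h := measureReal_le_abs_hitCount_sub hX hindep (Finset.Icc 1 n)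
      (measurableSet_coord_le r t) (show 0 < n * ε by positivity)
    rw [← marginalCDF_eq] at h
    simp only [Nat.card_Icc, Nat.add_sub_cancel] at h
    refine h.trans ?_
    have hle : marginalCDF μ r t ≤ 1 := cdf_le_one _ t
    have h2 : marginalCDF μ r t * (1 - marginalCDF μ r t) ≤ 1 - marginalCDF μ r t :=
      mul_le_of_le_one_left (by linarith) hle
    calc _ ≤ (n : ℝ) * (1 - marginalCDF μ r t) / (n * ε) ^ 2 := by gcongr
      _ = _ := by field_simp
  have hp := hdev (genInv (marginalCDF μ r) (q + ε))
  have hm := hdev (genInv (marginalCDF μ r) (q - ε))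
  rw [marginalCDF_genInv hF r (by linarith) h1] at hp
  rw [marginalCDF_genInv hF r h0 (by linarith)] at hm
  have hsub : badEvent μ X n r q ε ⊆
      {ω | n * ε ≤ |hitCount X (Finset.Icc 1 n)
        {x | x r ≤ genInv (marginalCDF μ r) (q + ε)} ω - n * (q + ε)|} ∪
      {ω | n * ε ≤ |hitCount X (Finset.Icc 1 n)
        {x | x r ≤ genInv (marginalCDF μ r) (q - ε)} ω - n * (q - ε)|} := by
    rintro ω (hω | hω)
    · left
      rw [empCDF_eq_hitCount, inv_mul_lt_iff₀ hn0] at hω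
      rw [Set.mem_ofPred_eq, le_abs]
      right; linarith
    · right
      rw [empCDF_eq_hitCount, le_inv_mul_iff₀ hn0] at hω
      rw [Set.mem_ofPred_eq, le_abs]
      left; linarith
  refine (measureReal_mono hsub).trans ((measureReal_union_le _ _).trans
    ((add_le_add hp hm).trans ?_))
  rw [← add_div]
  gcongr
  linarith

/-- The counts based on empirical quantiles are asymptotically equivalent to those based on the
true quantiles. -/
lemma tendstoInMeasure_hatCount_sub_hitCount (hF : Continuous (jointCDF μ))
    (hX : ∀ i, HasLaw (X i) μ P) (hindep : iIndepFun X P)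
    {M : ℕ → Finset ℕ} (hM : ∀ n, M n ⊆ Finset.Icc 1 n)
    (hmn : Tendsto (fun n : ℕ => ((M n).card : ℝ) / n) atTop (𝓝 0))
    {c : ℕ → ℝ} (hc : ∀ n, c n ∈ Set.Ioo (0 : ℝ) 1) (hc0 : Tendsto c atTop (𝓝 0))
    (hmc : Tendsto (fun n => ((M n).card : ℝ) * c n) atTop atTop) {a : ℝ} (ha : 0 < a) (j : ℕ) :
    TendstoInMeasure P (fun n ω => ((hatCount (fun i => X i ω) n (M n) (j + 1) (c n) : ℝ) -
      hitCount X (M n) (exceedSet μ (c n / (j + 1))) ω) / √((M n).card * c n * a)) atTop 0 := by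
  obtain ⟨s, hs0, hs, hs1, hs2⟩ := exists_bandwidth (fun n => (hc n).1) hmn hmc
  have hj : (0 : ℝ) < (j : ℝ) + 1 := by positivity
  set q : ℕ → ℝ := fun n => 1 - c n / (j + 1) with hq
  -- The window is taken relative to `c`: its expected count over `√(m c a)` is `2 √(m c) s / √a`,
  -- and the bad events have probability at most `3 / (j + 1)` times `1 / (n c s²)`.
  set ε : ℕ → ℝ := fun n => c n * s n with hεdef
  have hgood : ∀ᶠ n in atTop, 0 < ε n ∧ 0 < q n - ε n ∧ q n + ε n < 1 := by
    have hlim : Tendsto (fun n => c n / (j + 1) + c n * s n) atTop (𝓝 0) := by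
      simpa using (hc0.div_const _).add (hc0.mul hs)
    filter_upwards [hs0, hs.eventually_lt_const (show 0 < 1 / ((j : ℝ) + 1) by positivity),
      hlim.eventually_lt_const zero_lt_one] with n h1 h2 h3
    have hcn := (hc n).1
    refine ⟨mul_pos hcn h1, by simp only [hq, hεdef]; linarith, ?_⟩
    have : c n * s n < c n / (j + 1) := by
      rw [div_eq_mul_one_div]; exact mul_lt_mul_of_pos_left h2 hcn
    simp only [hq, hεdef]; linarith
  have hscale : Tendsto (fun n => √((M n).card * c n * a)) atTop atTop :=
    Real.tendsto_sqrt_atTop.comp (hmc.atTop_mul_const ha)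
  set B : ℕ → Fin d → Set (Fin d → ℝ) := fun n r =>
    {x | genInv (marginalCDF μ r) (q n - ε n) < x r ∧ x r ≤ genInv (marginalCDF μ r) (q n + ε n)}
  have hB : ∀ n r, MeasurableSet (B n r) := fun n r =>
    (measurableSet_lt measurable_const (measurable_pi_apply r)).inter (measurableSet_coord_le r _)
  have hBlim : ∀ r, TendstoInMeasure P
      (fun n ω => hitCount X (M n) (B n r) ω / √((M n).card * c n * a) - 0) atTop 0 := by
    intro r
    refine tendstoInMeasure_hitCount_div hX hindep (fun n => hB n r) hscale ?_
    have h := hs2.const_mul (2 / √a)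
    rw [mul_zero] at h
    refine h.congr' ?_
    filter_upwards [hgood, hmc.eventually_gt_atTop 0] with n hn hm0
    have e : μ.real (B n r) = 2 * (c n * s n) := by
      rw [measureReal_between_genInv hF r hn.2.1 (by linarith [hn.1]) hn.2.2]
      simp only [hεdef]; ring
    have hr : √((M n).card * c n) * √((M n).card * c n) = (M n).card * c n :=
      Real.mul_self_sqrt hm0.le
    rw [e, Real.sqrt_mul hm0.le, show ((M n).card : ℝ) * (2 * (c n * s n)) =
      (M n).card * c n * (2 * s n) by ring]
    nth_rw 2 [← hr]
    have : 0 < √((M n).card * c n) := Real.sqrt_pos.mpr hm0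
    have : 0 < √a := Real.sqrt_pos.mpr ha
    field_simp
  have hbad : ∀ r, Tendsto (fun n => P.real (badEvent μ X n r (q n) (ε n))) atTop (𝓝 0) := by
    intro r
    have h := hs1.const_mul (3 / ((j : ℝ) + 1))
    rw [mul_zero] at h
    refine squeeze_zero' (Eventually.of_forall fun _ => measureReal_nonneg) ?_ h
    filter_upwards [hgood, eventually_ge_atTop 1, hs0] with n hn hn1 hsn
    refine (measureReal_badEvent_le hF hX hindep hn1 r hn.1 hn.2.1 hn.2.2).trans (le_of_eq ?_)
    have := (hc n).1
    have : (0 : ℝ) < n := by exact_mod_cast hn1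
    simp only [hq, hεdef, sub_sub_cancel]
    field_simp
  -- The value `true` carries the window counts, `false` the bad events, where the trivial bound `(M
  -- n).card` is used.
  refine tendstoInMeasure_zero_of_norm_le_sum (ι := Bool × Fin d) (g := fun b => if b.1 then
    (fun n ω => hitCount X (M n) (B n b.2) ω / √((M n).card * c n * a) - 0) else
    (fun n => (badEvent μ X n b.2 (q n) (ε n)).indicator fun _ =>
      ((M n).card : ℝ) / √((M n).card * c n * a))) Finset.univ 1 ?_ ?_
  · filter_upwards [hgood] with n hn ω
    rw [one_mul, Fintype.sum_prod_type, Fintype.sum_bool, Real.norm_eq_abs, abs_div,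
      abs_of_nonneg (Real.sqrt_nonneg _)]
    simp only [if_true, Bool.false_eq_true, if_false, sub_zero]
    by_cases hω : ∀ r, ω ∉ badEvent μ X n r (q n) (ε n)
    · refine le_trans ?_ (le_add_of_nonneg_right (Finset.sum_nonneg fun _ _ => abs_nonneg _))
      refine (div_le_div_of_nonneg_right (abs_hatCount_sub_hitCount_le (hM n) (hc n) j hn.1
        hn.2.1 hn.2.2 ω hω) (Real.sqrt_nonneg _)).trans ?_
      rw [Finset.sum_div]
      exact Finset.sum_le_sum fun r _ => le_abs_self _
    · push Not at hω
      obtain ⟨r, hr⟩ := hω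
      refine le_trans ?_ (le_add_of_nonneg_left (Finset.sum_nonneg fun _ _ => abs_nonneg _))
      refine (div_le_div_of_nonneg_right (abs_hatCount_sub_hitCount_le_card _ _ _ _ _ _)
        (Real.sqrt_nonneg _)).trans ?_
      refine le_trans ?_ (Finset.single_le_sum (fun _ _ => abs_nonneg _) (Finset.mem_univ r))
      rw [Set.indicator_of_mem hr]
      exact le_abs_self _
  · rintro ⟨_ | _, r⟩ _
    · exact tendstoInMeasure_indicator_const (hbad r) _
    · exact hBlim r

end Quantiles

end

/-! ### Assembly. -/

theorem mainTheorem2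
    {Ω Ω' : Type*} [MeasurableSpace Ω] [MeasurableSpace Ω']
    (P : Measure Ω) [IsProbabilityMeasure P] (P' : Measure Ω') [IsProbabilityMeasure P']
    (d : ℕ) (hd : 1 ≤ d) (k : ℕ) (hk : 2 ≤ k)
    (μ : Measure (Fin d → ℝ)) [IsProbabilityMeasure μ]
    (hF : Continuous (jointCDF μ))
    (δ : ℝ) (hδ : 0 < δ) (hC : InDeltaNeighborhood (copulaOf μ) δ)
    (X : ℕ → Ω → Fin d → ℝ) (hXlaw : ∀ i, HasLaw (X i) μ P) (hXindep : iIndepFun X P)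
    (M : ℕ → Finset ℕ) (hM : ∀ n, M n ⊆ Finset.Icc 1 n)
    (hm : Tendsto (fun n => ((M n).card : ℝ)) atTop atTop)
    (hmlog : Tendsto (fun n : ℕ => ((M n).card : ℝ) * Real.log ((M n).card : ℝ) / (n : ℝ))
      atTop (𝓝 0))
    (c : ℕ → ℝ) (hc : ∀ n, c n ∈ Set.Ioo (0 : ℝ) 1)
    (hc0 : Tendsto c atTop (𝓝 0))
    (hmc : Tendsto (fun n => ((M n).card : ℝ) * c n) atTop atTop)
    (hmcδ : Tendsto (fun n => ((M n).card : ℝ) * c n ^ (1 + 2 * δ)) atTop (𝓝 0))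
    (ξ : Fin (k - 1) → Ω' → ℝ) (hξlaw : ∀ i, HasLaw (ξ i) (gaussianReal 0 1) P')
    (hξindep : iIndepFun ξ P') :
    TendstoInDistribution
      (fun (n : ℕ) (ω : Ω) => hatT k (fun i => X i ω) n (M n) (c n)) atTop
      (fun ω' => ∑ i : Fin (k - 1), limitWeight k ((i : ℕ) + 1) * ξ i ω' ^ 2)
      (fun _ => P) P' := by
  -- Eventually `log m ≥ 1`, so `m / n` is dominated by `m log m / n`.
  have hmn : Tendsto (fun n : ℕ => ((M n).card : ℝ) / n) atTop (𝓝 0) := by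
    refine squeeze_zero' (Eventually.of_forall fun n => by positivity) ?_ hmlog
    filter_upwards [(Real.tendsto_log_atTop.comp hm).eventually_ge_atTop 1] with n hn
    exact div_le_div_of_nonneg_right (le_mul_of_one_le_right (Nat.cast_nonneg _) hn)
      (Nat.cast_nonneg _)
  obtain ⟨a, ha, hrate⟩ := exists_tendsto_exceed_rate hd hδ hC hc hc0 hmc hmcδ
  have hanti : ∀ n, Antitone fun j : ℕ => exceedSet μ (c n / (j + 1)) := fun n i j hij => by
    have hcn := hc n
    have h1 : (i : ℝ) ≤ j := by exact_mod_cast hij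
    have h0 : (0 : ℝ) ≤ i := Nat.cast_nonneg i
    refine exceedSet_mono (div_pos hcn.1 (by linarith)) ?_
      ((div_le_self hcn.1.le (by linarith)).trans_lt hcn.2)
    exact div_le_div_of_nonneg_left hcn.1.le (by linarith) (by linarith)
  have hXm : AEMeasurable (fun ω i => X i ω) P :=
    aemeasurable_pi_lambda _ fun i => (hXlaw i).aemeasurable
  have key := tendstoInDistribution_quadratic_statistic (by omega : 1 ≤ k) hXlaw hXindep
    (tendsto_natCast_atTop_iff.mp hm) (A := fun n j => exceedSet μ (c n / (j + 1)))
    (fun n j => measurableSet_exceedSet _) hanti (hmc.atTop_mul_const ha) hrate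
    (N := fun n j ω => (hatCount (fun i => X i ω) n (M n) (j + 1) (c n) : ℝ))
    (fun n j => (measurable_hatCount (hM n) j (hc n)).comp_aemeasurable hXm)
    (fun j => tendstoInMeasure_hatCount_sub_hitCount hF hXlaw hXindep hM hmn hc hc0 hmc ha j)
    hξlaw hξindep
  have hsum : ∀ f : ℕ → ℝ, ∑ l ∈ Finset.Icc 1 k, f l = ∑ l ∈ Finset.range k, f (l + 1) := fun f => by
    rw [Finset.range_eq_Ico, Finset.sum_Ico_add' f 0 k 1]
    rfl
  refine key.congr (fun n => ae_of_all _ fun ω => ?_) (ae_of_all _ fun _ => rfl)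
  simp only [hatT, hatMean, hsum]
  push_cast
  rfl
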